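/- Let $K$ be a field and let $G$ be a finite simple graph on a vertex set $V$ which has at least one edge. Let $S=K[V]$ be the polynomial ring over $K$ whose variables are the vertices of $G$, with its standard $\mathbb{N}^V$-grading, and let $I(G)=(uv : \{u,v\}\in E(G))\subset S$ be the edge ideal of $G$. Let $\beta_{i,\sigma}(S/I(G))$ be the graded Betti numbers of $S/I(G)$, that is, the number of summands $S(-\sigma)$ in homological degree $i$ of a minimal $\mathbb{N}^V$-graded free resolution of $S/I(G)$, and put $$\operatorname{reg}(S/I(G))=\max\{|\sigma|-i : \beta_{i,\sigma}(S/I(G))\neq 0\},\qquad \operatorname{pd}(S/I(G))=\max\{i : \beta_{i,\sigma}(S/I(G))\neq 0 \text{ for some } \sigma\},$$ where $|\sigma|=\sum_{v\in V}\sigma_v$. Two edges $e_1,e_2$ of $G$ are called $3$-disjoint if $e_1\cap e_2=\emptyset$ and $e_1,e_2$ are the only edges of the subgraph of $G$ induced on $e_1\cup e_2$; let $a(G)$ be the maximum cardinality of a set of pairwise $3$-disjoint edges of $G$. Suppose that $G$ is co-chordal, that is, every cycle of length greater than $3$ in the complementary graph of $G$ has a chord. Then $$\operatorname{reg}(S/I(G))=a(G)=1$$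 and $$\operatorname{pd}(S/I(G))=\max\{m+n-1 : m,n\ge 1 \text{ and } G \text{ contains a complete bipartite subgraph of type } (m,n)\},$$ where a complete bipartite subgraph of type $(m,n)$ is a not necessarily induced subgraph of $G$ whose vertex set is the disjoint union of sets $V_1,V_2$ with $\#V_1=m$, $\#V_2=n$ and whose edges are all the pairs $\{v_1,v_2\}$ with $v_1\in V_1$, $v_2\in V_2$. -/

import Mathlib

namespace EdgeIdeal

open MvPolynomial

section Graphs

variable {V : Type*}

/-- A graph is chordal if every cycle of length greater than `3` has a chord: an edge of the graph
joining two vertices of the cycle which is not an edge of the cycle. -/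
def IsChordal (G : SimpleGraph V) : Prop :=
  ∀ (u : V) (c : G.Walk u u), c.IsCycle → 3 < c.length →
    ∃ x ∈ c.support, ∃ y ∈ c.support, G.Adj x y ∧ s(x, y) ∉ c.edges

/-- A graph is co-chordal if its complementary graph is chordal. -/
def IsCochordal (G : SimpleGraph V) : Prop :=
  IsChordal Gᶜ

/-- Two edges `e₁`, `e₂` of `G` are `3`-disjoint if they have no common vertex and the subgraph
of `G` induced on `e₁ ∪ e₂` has edge set `{e₁, e₂}`. -/
def ThreeDisjoint (G : SimpleGraph V) (e₁ e₂ : Sym2 V) : Prop :=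
  (∀ v, ¬ (v ∈ e₁ ∧ v ∈ e₂)) ∧
    {e ∈ G.edgeSet | ∀ v ∈ e, v ∈ e₁ ∨ v ∈ e₂} = {e₁, e₂}

/-- The cardinalities of the pairwise `3`-disjoint sets of edges of `G`; the invariant `a(G)` is
the maximum of this set. -/
def threeDisjointCards (G : SimpleGraph V) : Set ℕ :=
  {r | ∃ A : Finset (Sym2 V), (A : Set (Sym2 V)) ⊆ G.edgeSet ∧
    (A : Set (Sym2 V)).Pairwise (ThreeDisjoint G) ∧ A.card = r}

/-- The numbers `m + n - 1`, over all `m, n ≥ 1` such that `G` contains a (not necessarily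
induced) complete bipartite subgraph of type `(m, n)`. -/
def completeBipartiteValues (G : SimpleGraph V) : Set ℕ :=
  {p | ∃ m n : ℕ, 1 ≤ m ∧ 1 ≤ n ∧
    (completeBipartiteGraph (Fin m) (Fin n)).IsContained G ∧ p = m + n - 1}

/-- The edge ideal `I(G)` of the polynomial ring `K[V]`, generated by the products `u v` for the
edges `{u, v}` of `G`. -/
noncomputable def edgeIdeal (K : Type*) [Field K] (G : SimpleGraph V) : Ideal (MvPolynomial V K) :=
  Ideal.span {f | ∃ u v : V, G.Adj u v ∧ f = X u * X v}

end Graphs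

/-- The `ℕ^V`-grading on `K[V] / I` induced by the standard `ℕ^V`-grading of `K[V]`: the piece of
degree `σ` is the image of `K · x^σ`. It is used here for monomial ideals `I`. -/
noncomputable def quotientGrading {V K : Type*} [Field K] (I : Ideal (MvPolynomial V K))
    (σ : V →₀ ℕ) : Submodule K (MvPolynomial V K ⧸ I) :=
  (LinearMap.range (monomial σ : K →ₗ[K] MvPolynomial V K)).map
    (Ideal.Quotient.mkₐ K I).toLinearMap

/-- A minimal `ℕ^V`-graded free resolution `⋯ → F₁ → F₀ → M → 0` of an `ℕ^V`-graded module `M`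
over `S = K[V]`, the pieces of `M` being given by `ℳ`.
The `i`-th free module `F_i` is the direct sum of the `S(-deg i k)` over `k : ι i`, a finite set;
so it is `ι i → S`, where the `k`-th standard basis vector has degree `deg i k`.
The length is not restricted in advance: the length is `p` exactly when `p` is the greatest index
with `ι p` nonempty. -/
structure MinimalFreeResolution {V K : Type*} [Field K] {M : Type*} [AddCommGroup M]
    [Module K M] [Module (MvPolynomial V K) M] (ℳ : (V →₀ ℕ) → Submodule K M) where
  /-- the index set of the standard basis of `F_i` -/
  ι : ℕ → Type
  [fintype : ∀ i, Fintype (ι i)]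
  [decidableEq : ∀ i, DecidableEq (ι i)]
  /-- the degrees of the standard basis vectors -/
  deg : ∀ i, ι i → (V →₀ ℕ)
  /-- the differential `F_{i+1} → F_i` -/
  d : ∀ i, (ι (i + 1) → MvPolynomial V K) →ₗ[MvPolynomial V K] (ι i → MvPolynomial V K)
  /-- the augmentation `F₀ → M` -/
  ε : (ι 0 → MvPolynomial V K) →ₗ[MvPolynomial V K] M
  /-- the differentials preserve degrees: every monomial `x^τ` which occurs in the coordinate
  at `l` of the image of the basis vector `k` satisfies `τ + deg l = deg k` -/
  d_homogeneous : ∀ i (k : ι (i + 1)) (l : ι i), ∀ τ ∈ (d i (Pi.single k 1) l).support,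
    τ + deg i l = deg (i + 1) k
  /-- the augmentation preserves degrees -/
  ε_homogeneous : ∀ k : ι 0, ε (Pi.single k 1) ∈ ℳ (deg 0 k)
  ε_surjective : Function.Surjective ε
  exact_zero : Function.Exact (d 0) ε
  exact_succ : ∀ i, Function.Exact (d (i + 1)) (d i)
  /-- minimality: the image of `F_{i+1}` lies in `𝔪 F_i`, where `𝔪` is the ideal generated by the
  variables, that is, the ideal of the polynomials without constant term -/
  minimal : ∀ i x (l : ι i), constantCoeff (d i x l) = 0

namespace MinimalFreeResolution

variable {V K : Type*} [Field K] {M : Type*} [AddCommGroup M] [Module K M]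
  [Module (MvPolynomial V K) M] {ℳ : (V →₀ ℕ) → Submodule K M}

/-- The graded Betti number `β_{i,σ}(M)`: the number of summands `S(-σ)` in `F_i`. -/
noncomputable def betti (F : MinimalFreeResolution ℳ) (i : ℕ) (σ : V →₀ ℕ) : ℕ :=
  Nat.card {k : F.ι i // F.deg i k = σ}

/-- `pd M = p`, that is, `p = max {i : β_{i,σ}(M) ≠ 0 for some σ}`, the maximum being attained. -/
def HasProjDim (F : MinimalFreeResolution ℳ) (p : ℕ) : Prop :=
  IsGreatest {i : ℕ | ∃ σ, F.betti i σ ≠ 0} p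

/-- `reg M = r`, that is, `r = max {|σ| - i : β_{i,σ}(M) ≠ 0}`, the maximum being attained. -/
def HasRegularity (F : MinimalFreeResolution ℳ) (r : ℤ) : Prop :=
  IsGreatest {q : ℤ | ∃ (i : ℕ) (σ : V →₀ ℕ), F.betti i σ ≠ 0 ∧ q = (σ.degree : ℤ) - (i : ℤ)} r

end MinimalFreeResolution

end EdgeIdeal

/-! Write S/I(G) degree by degree: it has a copy of K in each degree outside I(G), so its minimal
resolution can be studied through finite-dimensional strands (`StrandResolution`). Such resolutions
are built by mapping cones, eliminating one vertex at a time.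

By Dirac's theorem every nonempty induced subgraph of the chordal complement has a simplicial vertex
v. In G this means that the set N of neighbours of v meets every edge
(`IsCochordal.exists_neighbors_cover`). With H = G - v and P = (N), this gives I(H) ⊆ P and I(G) =
I(H) + x_v P, hence exact sequences 0 → I(H) → P → P/I(H) → 0 and 0 → (P/I(H))(-v) → S/I(H) → S/I(G)
→ 0. P has the Koszul resolution, and I(H) is resolved by induction. In both cones the two
resolutions have different total degrees in each homological place, so the cones are minimal
(`exists_cone`). The result is linear: place i + 1 lives in total degree i + 2, so the regularity is
1. The places that are nonzero satisfy a recursion, which is also satisfied by the sizes of the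
complete bipartite subgraphs (`hasBipartite_iff_erase`); this gives the projective dimension.

Any two minimal resolutions have the same degrees in each place (`exists_deg_eq`), so the
computation applies to all of them. Finally a(G) = 1, because the covering property applied to the
endpoints of two edges excludes 3-disjointness. -/

namespace EdgeIdeal

/-! ### Strands of multigraded resolutions and their uniqueness. -/

section Strands

variable {D : Type*} [PartialOrder D] {K : Type*} [Field K]

/-- The vectors which are supported on the basis elements of degree at most `σ`. -/
def strand (K : Type*) [Field K] {ι : Type*} (deg : ι → D) (σ : D) : Submodule K (ι → K) where
  carrier := {x | ∀ k, x k ≠ 0 → deg k ≤ σ}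
  zero_mem' := by simp
  add_mem' := by
    intro x y hx hy k hk
    by_cases h : x k = 0
    · exact hy k (by simpa [h] using hk)
    · exact hx k h
  smul_mem' := by
    intro c x hx k hk
    exact hx k (by rintro h; simp [h] at hk)

theorem mem_strand {ι : Type*} {deg : ι → D} {σ : D} {x : ι → K} :
    x ∈ strand K deg σ ↔ ∀ k, x k ≠ 0 → deg k ≤ σ := Iff.rfl

theorem single_mem_strand {ι : Type*} [DecidableEq ι] {deg : ι → D} {σ : D} {k : ι}
    (h : deg k ≤ σ) (c : K) : Pi.single k c ∈ strand K deg σ := by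
  intro l hl
  by_cases hlk : l = k
  · exact hlk ▸ h
  · simp [hlk] at hl

/-- A linear map is filtered if it does not increase degrees. -/
def IsFiltered {ι κ : Type*} (deg : ι → D) (deg' : κ → D) (f : (ι → K) →ₗ[K] (κ → K)) : Prop :=
  ∀ x l, f x l ≠ 0 → ∃ k, x k ≠ 0 ∧ deg' l ≤ deg k

/-- A linear map is strictly filtered if it decreases degrees. -/
def IsStrictlyFiltered {ι κ : Type*} (deg : ι → D) (deg' : κ → D)
    (f : (ι → K) →ₗ[K] (κ → K)) : Prop :=
  ∀ x l, f x l ≠ 0 → ∃ k, x k ≠ 0 ∧ deg' l < deg k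

theorem IsFiltered.mem_strand {ι κ : Type*} {deg : ι → D} {deg' : κ → D}
    {f : (ι → K) →ₗ[K] (κ → K)} (hf : IsFiltered deg deg' f) {σ : D} {x : ι → K}
    (hx : x ∈ strand K deg σ) : f x ∈ strand K deg' σ := fun l hl ↦
  let ⟨k, hk, hlk⟩ := hf x l hl
  hlk.trans (hx k hk)

theorem IsFiltered.comp {ι κ μ : Type*} {deg : ι → D} {deg' : κ → D} {deg'' : μ → D}
    {g : (κ → K) →ₗ[K] (μ → K)} {f : (ι → K) →ₗ[K] (κ → K)} (hg : IsFiltered deg' deg'' g)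
    (hf : IsFiltered deg deg' f) : IsFiltered deg deg'' (g ∘ₗ f) := by
  intro x m hm
  obtain ⟨l, hl, hml⟩ := hg _ m hm
  obtain ⟨k, hk, hlk⟩ := hf _ l hl
  exact ⟨k, hk, hml.trans hlk⟩

theorem IsFiltered.sub {ι κ : Type*} {deg : ι → D} {deg' : κ → D}
    {g f : (ι → K) →ₗ[K] (κ → K)} (hg : IsFiltered deg deg' g)
    (hf : IsFiltered deg deg' f) : IsFiltered deg deg' (g - f) := by
  intro x m hm
  by_cases h : g x m = 0
  · exact hf x m (fun h' ↦ hm (by simp [h, h']))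
  · exact hg x m h

theorem IsFiltered.id {ι : Type*} (deg : ι → D) :
    IsFiltered deg deg (LinearMap.id : (ι → K) →ₗ[K] (ι → K)) :=
  fun _ l hl ↦ ⟨l, hl, le_rfl⟩

theorem IsStrictlyFiltered.isFiltered {ι κ : Type*} {deg : ι → D} {deg' : κ → D}
    {f : (ι → K) →ₗ[K] (κ → K)} (hf : IsStrictlyFiltered deg deg' f) : IsFiltered deg deg' f :=
  fun x l hl ↦ (hf x l hl).imp fun _ h ↦ ⟨h.1, h.2.le⟩

theorem linearMap_apply_eq_sum_single {S ι M : Type*} [CommSemiring S] [Fintype ι]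
    [DecidableEq ι] [AddCommMonoid M] [Module S M] (f : (ι → S) →ₗ[S] M) (x : ι → S) :
    f x = ∑ k, x k • f (Pi.single k 1) := by
  rw [LinearMap.pi_apply_eq_sum_univ f x]
  refine Finset.sum_congr rfl fun k _ ↦ ?_
  congr 2
  ext j
  simp [Pi.single_apply, eq_comm]

theorem pi_apply_eq_sum_single {S ι κ : Type*} [CommSemiring S] [Fintype ι] [DecidableEq ι]
    (f : (ι → S) →ₗ[S] (κ → S)) (x : ι → S) (l : κ) :
    f x l = ∑ k, x k * f (Pi.single k 1) l := by
  rw [linearMap_apply_eq_sum_single f x]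
  simp only [Finset.sum_apply, Pi.smul_apply, smul_eq_mul]

theorem exists_linearMap_single {S ι M : Type*} [CommSemiring S] [Fintype ι]
    [DecidableEq ι] [AddCommMonoid M] [Module S M] (y : ι → M) :
    ∃ f : (ι → S) →ₗ[S] M, ∀ k, f (Pi.single k 1) = y k :=
  ⟨(Pi.basisFun S ι).constr S y, fun k ↦ by
    rw [← Pi.basisFun_apply, Module.Basis.constr_basis]⟩

theorem isFiltered_of_single {ι κ : Type*} [Fintype ι] [DecidableEq ι] {deg : ι → D}
    {deg' : κ → D} {f : (ι → K) →ₗ[K] (κ → K)}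
    (h : ∀ k l, f (Pi.single k 1) l ≠ 0 → deg' l ≤ deg k) : IsFiltered deg deg' f := by
  intro x l hl
  rw [pi_apply_eq_sum_single] at hl
  obtain ⟨k, -, hk⟩ := Finset.exists_ne_zero_of_sum_ne_zero hl
  exact ⟨k, left_ne_zero_of_mul hk, h k l (right_ne_zero_of_mul hk)⟩

theorem isStrictlyFiltered_of_single {ι κ : Type*} [Fintype ι] [DecidableEq ι] {deg : ι → D}
    {deg' : κ → D} {f : (ι → K) →ₗ[K] (κ → K)}
    (h : ∀ k l, f (Pi.single k 1) l ≠ 0 → deg' l < deg k) : IsStrictlyFiltered deg deg' f := by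
  intro x l hl
  rw [pi_apply_eq_sum_single] at hl
  obtain ⟨k, -, hk⟩ := Finset.exists_ne_zero_of_sum_ne_zero hl
  exact ⟨k, left_ne_zero_of_mul hk, h k l (right_ne_zero_of_mul hk)⟩

theorem linearMap_ext_single {ι M : Type*} [Fintype ι] [DecidableEq ι] [AddCommGroup M]
    [Module K M] {f g : (ι → K) →ₗ[K] M}
    (h : ∀ k, f (Pi.single k 1) = g (Pi.single k 1)) : f = g :=
  (Pi.basisFun K ι).ext fun k ↦ by simpa using h k

/-- Graded projectivity of free modules: it suffices to lift each basis vector inside the strand of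
its own degree. -/
theorem exists_filtered_lift {ι κ M : Type*} [Fintype ι] [DecidableEq ι] [AddCommGroup M]
    [Module K M] {deg : ι → D} {deg' : κ → D} (u : (ι → K) →ₗ[K] M) (c : (κ → K) →ₗ[K] M)
    (h : ∀ k, ∃ y ∈ strand K deg' (deg k), c y = u (Pi.single k 1)) :
    ∃ f : (ι → K) →ₗ[K] (κ → K), IsFiltered deg deg' f ∧ c ∘ₗ f = u := by
  choose y hy hcy using h
  obtain ⟨f, hf⟩ := exists_linearMap_single (S := K) y
  refine ⟨f, isFiltered_of_single fun k l hl ↦ ?_, linearMap_ext_single fun k ↦ ?_⟩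
  · rw [hf] at hl
    exact hy k l hl
  · rw [LinearMap.comp_apply, hf, hcy]

variable (K) in
/-- The strands of a minimal graded free resolution of the module with a copy of `K` in each degree
in `C`, in which multiplication is the identity of `K` whenever that is possible. The `i`-th free
module has a basis indexed by `ι i`; its piece of degree `σ` has as basis the elements of `ι i` of
degree at most `σ`. -/
structure StrandResolution (C : Set D) where
  /-- the index set of the basis of the `i`-th free module -/
  ι : ℕ → Type
  [fintype : ∀ i, Fintype (ι i)]
  [decidableEq : ∀ i, DecidableEq (ι i)]
  /-- the degrees of the basis elements -/
  deg : ∀ i, ι i → D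
  /-- the differential -/
  d : ∀ i, (ι (i + 1) → K) →ₗ[K] (ι i → K)
  /-- the augmentation -/
  a : (ι 0 → K) →ₗ[K] K
  d_strict : ∀ i, IsStrictlyFiltered (deg (i + 1)) (deg i) (d i)
  a_mem : ∀ x, a x ≠ 0 → ∃ k, x k ≠ 0 ∧ deg 0 k ∈ C
  a_surj : ∀ σ ∈ C, ∃ x ∈ strand K (deg 0) σ, a x = 1
  -- Outside `C` the resolved module is zero, so there every element of the strand has to be a
  -- boundary.
  exact_zero : ∀ σ, ∀ x ∈ strand K (deg 0) σ,
    (∃ y ∈ strand K (deg 1) σ, d 0 y = x) ↔ (σ ∈ C → a x = 0)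
  exact_succ : ∀ i σ, ∀ x ∈ strand K (deg (i + 1)) σ,
    (∃ y ∈ strand K (deg (i + 2)) σ, d (i + 1) y = x) ↔ d i x = 0

namespace StrandResolution

attribute [instance] fintype decidableEq

variable {A B C : Set D}

theorem d_filtered (R : StrandResolution K C) (i : ℕ) :
    IsFiltered (R.deg (i + 1)) (R.deg i) (R.d i) :=
  (R.d_strict i).isFiltered

theorem d_comp_d (R : StrandResolution K C) (i : ℕ) : R.d i ∘ₗ R.d (i + 1) = 0 := by
  refine linearMap_ext_single fun k ↦ ?_
  have hk := single_mem_strand (K := K) (deg := R.deg (i + 2)) (le_refl (R.deg (i + 2) k)) 1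
  exact (R.exact_succ i _ _ ((R.d_filtered (i + 1)).mem_strand hk)).1 ⟨_, hk, rfl⟩

theorem a_d_eq_zero (R : StrandResolution K C) {σ : D} (hσ : σ ∈ C) {y : R.ι 1 → K}
    (hy : y ∈ strand K (R.deg 1) σ) : R.a (R.d 0 y) = 0 :=
  (R.exact_zero σ _ ((R.d_filtered 0).mem_strand hy)).1 ⟨y, hy, rfl⟩ hσ

/-- The condition `hup` says that `A` is a submodule of `B`. A basis element of degree in `A` lying
below `σ ∈ B` would put `σ` in `A`. -/
theorem a_eq_zero (R : StrandResolution K A) (hup : ∀ σ ∈ A, ∀ τ ∈ B, σ ≤ τ → τ ∈ A)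
    {σ : D} (hσB : σ ∈ B) (hσA : σ ∉ A) {x : R.ι 0 → K} (hx : x ∈ strand K (R.deg 0) σ) :
    R.a x = 0 := by
  by_contra h
  obtain ⟨k, hk, hkA⟩ := R.a_mem x h
  exact hσA (hup _ hkA _ hσB (hx k hk))

theorem a_d_eq_zero_of_upper (R : StrandResolution K A)
    (hup : ∀ σ ∈ A, ∀ τ ∈ B, σ ≤ τ → τ ∈ A) {σ : D} (hσ : σ ∈ B) {y : R.ι 1 → K}
    (hy : y ∈ strand K (R.deg 1) σ) : R.a (R.d 0 y) = 0 := by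
  by_cases hA : σ ∈ A
  · exact R.a_d_eq_zero hA hy
  · exact R.a_eq_zero hup hσ hA ((R.d_filtered 0).mem_strand hy)

/-- The comparison theorem for the inclusion of modules `A ⊆ B`: basis vectors are lifted place by
place, using exactness of `T` in their degrees. -/
theorem exists_chainMap (R : StrandResolution K A) (T : StrandResolution K B) (hAB : A ⊆ B)
    (hup : ∀ σ ∈ A, ∀ τ ∈ B, σ ≤ τ → τ ∈ A) :
    ∃ f : ∀ i, (R.ι i → K) →ₗ[K] (T.ι i → K), (∀ i, IsFiltered (R.deg i) (T.deg i) (f i)) ∧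
      T.a ∘ₗ f 0 = R.a ∧ ∀ i, T.d i ∘ₗ f (i + 1) = f i ∘ₗ R.d i := by
  classical
  obtain ⟨f₀, hf₀, haf₀⟩ : ∃ f : (R.ι 0 → K) →ₗ[K] (T.ι 0 → K),
      IsFiltered (R.deg 0) (T.deg 0) f ∧ T.a ∘ₗ f = R.a := by
    refine exists_filtered_lift _ _ fun k ↦ ?_
    by_cases hk : R.a (Pi.single k 1) = 0
    · exact ⟨0, zero_mem _, by simp [hk]⟩
    · obtain ⟨l, hl, hlA⟩ := R.a_mem _ hk
      obtain rfl : l = k := by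
        by_contra h
        simp [h] at hl
      obtain ⟨x, hx, hax⟩ := T.a_surj _ (hAB hlA)
      exact ⟨R.a (Pi.single l 1) • x, Submodule.smul_mem _ _ hx, by simp [hax]⟩
  let P (i : ℕ) (g : (R.ι i → K) →ₗ[K] (T.ι i → K))
    (h : (R.ι (i + 1) → K) →ₗ[K] (T.ι (i + 1) → K)) : Prop :=
    IsFiltered (R.deg (i + 1)) (T.deg (i + 1)) h ∧ T.d i ∘ₗ h = g ∘ₗ R.d i
  -- Each map is chosen after the previous one. The default 0 never occurs, since `hP` shows
  -- inductively that a next map exists.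
  let f : ∀ i, (R.ι i → K) →ₗ[K] (T.ι i → K) := fun i ↦
    Nat.rec f₀ (fun i g ↦ if h : ∃ h, P i g h then h.choose else 0) i
  have hstep : ∀ i, (∃ h, P i (f i) h) → P i (f i) (f (i + 1)) := fun i h ↦ by
    have : f (i + 1) = h.choose := dif_pos h
    rw [this]
    exact h.choose_spec
  have hP : ∀ i, P i (f i) (f (i + 1)) := by
    intro i
    induction i with
    | zero =>
      refine hstep 0 (exists_filtered_lift _ _ fun k ↦ ?_)
      have hk := single_mem_strand (K := K) (deg := R.deg 1) (le_refl (R.deg 1 k)) 1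
      refine (T.exact_zero _ _ (hf₀.mem_strand ((R.d_filtered 0).mem_strand hk))).2 fun hB ↦ ?_
      exact (LinearMap.congr_fun haf₀ _).trans (R.a_d_eq_zero_of_upper hup hB hk)
    | succ i ih =>
      refine hstep (i + 1) (exists_filtered_lift _ _ fun k ↦ ?_)
      have hk := single_mem_strand (K := K) (deg := R.deg (i + 2)) (le_refl (R.deg (i + 2) k)) 1
      refine (T.exact_succ _ _ _ (ih.1.mem_strand ((R.d_filtered (i + 1)).mem_strand hk))).2 ?_
      refine (LinearMap.congr_fun ih.2 _).trans ?_
      rw [LinearMap.comp_apply, ← LinearMap.comp_apply (R.d i), R.d_comp_d]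
      simp
  exact ⟨f, fun i ↦ match i with
    | 0 => hf₀
    | i + 1 => (hP i).1, haf₀, fun i ↦ (hP i).2⟩

/-- A chain endomorphism lifting the identity is homotopic to the identity; the homotopy is built by
the same recursion as the comparison maps. -/
theorem exists_homotopy (R : StrandResolution K C) (φ : ∀ i, (R.ι i → K) →ₗ[K] (R.ι i → K))
    (hφ : ∀ i, IsFiltered (R.deg i) (R.deg i) (φ i)) (ha : R.a ∘ₗ φ 0 = R.a)
    (hd : ∀ i, R.d i ∘ₗ φ (i + 1) = φ i ∘ₗ R.d i) :
    ∃ h : ∀ i, (R.ι i → K) →ₗ[K] (R.ι (i + 1) → K),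
      (∀ i, IsFiltered (R.deg i) (R.deg (i + 1)) (h i)) ∧
      R.d 0 ∘ₗ h 0 = φ 0 - LinearMap.id ∧
      ∀ i, R.d (i + 1) ∘ₗ h (i + 1) = φ (i + 1) - LinearMap.id - h i ∘ₗ R.d i := by
  classical
  obtain ⟨h₀, hh₀, hdh₀⟩ : ∃ h : (R.ι 0 → K) →ₗ[K] (R.ι 1 → K),
      IsFiltered (R.deg 0) (R.deg 1) h ∧ R.d 0 ∘ₗ h = φ 0 - LinearMap.id := by
    refine exists_filtered_lift _ _ fun k ↦ ?_
    have hk := single_mem_strand (K := K) (deg := R.deg 0) (le_refl (R.deg 0 k)) 1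
    refine (R.exact_zero _ _ (((hφ 0).sub (IsFiltered.id _)).mem_strand hk)).2 fun _ ↦ ?_
    rw [LinearMap.sub_apply, map_sub, LinearMap.id_apply, sub_eq_zero]
    exact LinearMap.congr_fun ha (Pi.single k 1)
  let P (i : ℕ) (g : (R.ι i → K) →ₗ[K] (R.ι (i + 1) → K))
    (h : (R.ι (i + 1) → K) →ₗ[K] (R.ι (i + 2) → K)) : Prop :=
    IsFiltered (R.deg (i + 1)) (R.deg (i + 2)) h ∧
      R.d (i + 1) ∘ₗ h = φ (i + 1) - LinearMap.id - g ∘ₗ R.d i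
  let f : ∀ i, (R.ι i → K) →ₗ[K] (R.ι (i + 1) → K) := fun i ↦
    Nat.rec h₀ (fun i g ↦ if h : ∃ h, P i g h then h.choose else 0) i
  have hstep : ∀ i, (∃ h, P i (f i) h) → P i (f i) (f (i + 1)) := fun i h ↦ by
    have : f (i + 1) = h.choose := dif_pos h
    rw [this]
    exact h.choose_spec
  have key : ∀ i, IsFiltered (R.deg i) (R.deg (i + 1)) (f i) →
      R.d i ∘ₗ f i ∘ₗ R.d i = (φ i - LinearMap.id) ∘ₗ R.d i → P i (f i) (f (i + 1)) := by
    intro i hf hdf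
    refine hstep i (exists_filtered_lift _ _ fun k ↦ ?_)
    have hk := single_mem_strand (K := K) (deg := R.deg (i + 1)) (le_refl (R.deg (i + 1) k)) 1
    refine (R.exact_succ _ _ _ ((((hφ (i + 1)).sub (IsFiltered.id _)).sub
      (hf.comp (R.d_filtered i))).mem_strand hk)).2 ?_
    have h1 := LinearMap.congr_fun hdf (Pi.single k 1)
    have h2 := LinearMap.congr_fun (hd i) (Pi.single k 1)
    simp only [LinearMap.comp_apply, LinearMap.sub_apply, LinearMap.id_apply, map_sub] at h1 h2 ⊢
    rw [h1, h2, sub_self]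
  have hP : ∀ i, P i (f i) (f (i + 1)) := by
    intro i
    induction i with
    | zero =>
      refine key 0 hh₀ ?_
      rw [← LinearMap.comp_assoc]
      exact congrArg (· ∘ₗ R.d 0) hdh₀
    | succ i ih =>
      refine key (i + 1) ih.1 ?_
      rw [← LinearMap.comp_assoc, ih.2, LinearMap.sub_comp, LinearMap.comp_assoc (R.d (i + 1)),
        R.d_comp_d, LinearMap.comp_zero, sub_zero]
  exact ⟨f, fun i ↦ match i with
    | 0 => hh₀
    | i + 1 => (hP i).1, hdh₀, fun i ↦ (hP i).2⟩

/-- Let f and g be comparison maps in both directions. Then gf - id = dh + hd, and by minimality d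
strictly lowers degrees, so dh + hd has zero diagonal. Hence the diagonal entry of gf at `k` is 1,
and it passes through some `l` whose degree is squeezed to that of `k`. -/
theorem exists_deg_eq (R T : StrandResolution K C) (i : ℕ) (k : R.ι i) :
    ∃ l : T.ι i, T.deg i l = R.deg i k := by
  obtain ⟨f, hf, haf, hdf⟩ := R.exists_chainMap T subset_rfl fun _ _ _ h _ ↦ h
  obtain ⟨g, hg, hag, hdg⟩ := T.exists_chainMap R subset_rfl fun _ _ _ h _ ↦ h
  obtain ⟨h, hh, hh₀, hhd⟩ := R.exists_homotopy (fun i ↦ g i ∘ₗ f i)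
    (fun i ↦ (hg i).comp (hf i)) (by rw [← LinearMap.comp_assoc, hag, haf])
    (fun i ↦ by rw [← LinearMap.comp_assoc, hdg, LinearMap.comp_assoc, hdf, LinearMap.comp_assoc])
  have hsingle : ∀ l, (Pi.single k 1 : R.ι i → K) l ≠ 0 → l = k := fun l hl ↦ by
    by_contra h
    simp [h] at hl
  have hdh : R.d i (h i (Pi.single k 1)) k = 0 := by
    by_contra hne
    obtain ⟨l, hl, hkl⟩ := R.d_strict i _ _ hne
    obtain ⟨m, hm, hlm⟩ := hh i _ _ hl
    rw [hsingle m hm] at hlm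
    exact (hkl.trans_le hlm).false
  have hne : g i (f i (Pi.single k 1)) k ≠ 0 := by
    cases i with
    | zero =>
      have := congrFun (LinearMap.congr_fun hh₀ (Pi.single k 1)) k
      simp only [LinearMap.comp_apply, hdh, LinearMap.sub_apply, LinearMap.id_apply, Pi.sub_apply,
        Pi.single_eq_same] at this
      exact fun h0 ↦ one_ne_zero ((sub_eq_zero.1 this.symm).symm.trans h0)
    | succ i =>
      have hhd' : h i (R.d i (Pi.single k 1)) k = 0 := by
        by_contra hne
        obtain ⟨l, hl, hkl⟩ := hh i _ _ hne
        obtain ⟨m, hm, hlm⟩ := R.d_strict i _ _ hl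
        rw [hsingle m hm] at hlm
        exact (hlm.trans_le hkl).false
      have := congrFun (LinearMap.congr_fun (hhd i) (Pi.single k 1)) k
      simp only [LinearMap.comp_apply, hdh, LinearMap.sub_apply, LinearMap.id_apply, Pi.sub_apply,
        Pi.single_eq_same, hhd', sub_zero] at this
      exact fun h0 ↦ one_ne_zero ((sub_eq_zero.1 this.symm).symm.trans h0)
  obtain ⟨l, hl, hkl⟩ := hg i _ _ hne
  obtain ⟨m, hm, hlm⟩ := hf i _ _ hl
  rw [hsingle m hm] at hlm
  exact ⟨l, hlm.antisymm hkl⟩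

end StrandResolution

end Strands

end EdgeIdeal

/-! ### Mapping cones, shifts and syzygies. -/

namespace EdgeIdeal

namespace StrandResolution

variable {D : Type*} [PartialOrder D] {K : Type*} [Field K] {A B C : Set D}

/-- The set of degrees of the basis elements of the `i`-th free module. -/
def degrees (R : StrandResolution K C) (i : ℕ) : Set D := Set.range (R.deg i)

/-- The resolved module is cyclic, with a generator in the least degree. -/
def IsCyclic [OrderBot D] (R : StrandResolution K C) : Prop :=
  Nonempty (Unique (R.ι 0)) ∧ ∀ k, R.deg 0 k = ⊥

theorem IsCyclic.degrees_zero [OrderBot D] {R : StrandResolution K C} (h : R.IsCyclic) :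
    R.degrees 0 = {⊥} := by
  obtain ⟨⟨_⟩, h⟩ := h
  ext σ
  simp [degrees, h, eq_comm]

theorem degrees_eq (R T : StrandResolution K C) (i : ℕ) : R.degrees i = T.degrees i := by
  ext σ
  constructor
  · rintro ⟨k, rfl⟩
    exact R.exists_deg_eq T i k
  · rintro ⟨k, rfl⟩
    exact T.exists_deg_eq R i k

/-- The basis index sets of a mapping cone. -/
abbrev coneι (α β : ℕ → Type) : ℕ → Type
  | 0 => β 0
  | i + 1 => β (i + 1) ⊕ α i

/-- The degrees of the basis elements of a mapping cone. -/
def coneDeg {α β : ℕ → Type} (deg : ∀ i, α i → D) (deg' : ∀ i, β i → D) :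
    ∀ i, coneι α β i → D
  | 0 => deg' 0
  | i + 1 => Sum.elim (deg' (i + 1)) (deg i)

theorem sumElim_mem_strand {α β : Type*} {deg : α → D} {deg' : β → D} {σ : D} {x : α → K}
    {y : β → K} : Sum.elim x y ∈ strand K (Sum.elim deg deg') σ ↔
      x ∈ strand K deg σ ∧ y ∈ strand K deg' σ := by
  simp [mem_strand]

theorem mem_strand_sum {α β : Type*} {deg : α → D} {deg' : β → D} {σ : D} {x : α ⊕ β → K} :
    x ∈ strand K (Sum.elim deg deg') σ ↔
      x ∘ Sum.inl ∈ strand K deg σ ∧ x ∘ Sum.inr ∈ strand K deg' σ := by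
  simp [mem_strand]

/-- The mapping cone of the chain map between minimal resolutions of modules `A ⊆ B`, which is a
minimal resolution of `B / A` if no degree occurs in both resolutions in the same place. -/
theorem exists_cone (R : StrandResolution K A) (T : StrandResolution K B) (hAB : A ⊆ B)
    (hup : ∀ σ ∈ A, ∀ τ ∈ B, σ ≤ τ → τ ∈ A) (hne : ∀ i k l, R.deg i k ≠ T.deg i l) :
    ∃ U : StrandResolution K (B \ A), (∀ [OrderBot D], T.IsCyclic → U.IsCyclic) ∧
      U.degrees 0 = T.degrees 0 ∧ ∀ i, U.degrees (i + 1) = T.degrees (i + 1) ∪ R.degrees i := by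
  classical
  obtain ⟨f, hf, haf, hdf⟩ := R.exists_chainMap T hAB hup
  have hdf' : ∀ i x, T.d i (f (i + 1) x) = f i (R.d i x) := fun i ↦ LinearMap.congr_fun (hdf i)
  have haf' : ∀ x, T.a (f 0 x) = R.a x := LinearMap.congr_fun haf
  have hdd : ∀ i x, T.d i (T.d (i + 1) x) = 0 := fun i ↦ LinearMap.congr_fun (T.d_comp_d i)
  have hdd' : ∀ i x, R.d i (R.d (i + 1) x) = 0 := fun i ↦ LinearMap.congr_fun (R.d_comp_d i)
  -- Minimality of the cone: since no degree is shared, the comparison map has no unit entries.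
  have hfs : ∀ i, IsStrictlyFiltered (R.deg i) (T.deg i) (f i) := fun i x l hl ↦
    let ⟨k, hk, hlk⟩ := hf i x l hl
    ⟨k, hk, hlk.lt_of_ne (hne i k l).symm⟩
  let inl : ∀ i, (T.ι (i + 1) ⊕ R.ι i → K) →ₗ[K] (T.ι (i + 1) → K) := fun i ↦
    LinearMap.funLeft K K Sum.inl
  let inr : ∀ i, (T.ι (i + 1) ⊕ R.ι i → K) →ₗ[K] (R.ι i → K) := fun i ↦
    LinearMap.funLeft K K Sum.inr
  let d : ∀ i, (coneι R.ι T.ι (i + 1) → K) →ₗ[K] (coneι R.ι T.ι i → K) := fun i ↦ match i with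
    | 0 => T.d 0 ∘ₗ inl 0 + f 0 ∘ₗ inr 0
    | i + 1 => (LinearEquiv.sumArrowLequivProdArrow _ _ K K).symm.toLinearMap ∘ₗ
        (T.d (i + 1) ∘ₗ inl (i + 1) + f (i + 1) ∘ₗ inr (i + 1)).prod (-(R.d i ∘ₗ inr (i + 1)))
  have hd₀ : ∀ x : T.ι 1 ⊕ R.ι 0 → K,
      d 0 x = T.d 0 (x ∘ Sum.inl) + f 0 (x ∘ Sum.inr) := fun _ ↦ rfl
  have hd : ∀ i (x : T.ι (i + 2) ⊕ R.ι (i + 1) → K),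
      d (i + 1) x = Sum.elim (T.d (i + 1) (x ∘ Sum.inl) + f (i + 1) (x ∘ Sum.inr))
        (-R.d i (x ∘ Sum.inr)) := fun i x ↦ by
    ext (k | k) <;> rfl
  -- the augmentation, set to zero outside of `B \ A`
  let cut : (T.ι 0 → K) →ₗ[K] (T.ι 0 → K) :=
    LinearMap.pi fun k ↦ if T.deg 0 k ∈ B \ A then LinearMap.proj k else 0
  have hcut : ∀ x k, cut x k = if T.deg 0 k ∈ B \ A then x k else 0 := fun x k ↦ by
    simp only [cut, LinearMap.pi_apply]
    split_ifs <;> rfl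
  have hacut : ∀ σ ∈ B \ A, ∀ x ∈ strand K (T.deg 0) σ, T.a (cut x) = T.a x := by
    intro σ hσ x hx
    rw [← sub_eq_zero, ← map_sub]
    by_contra h
    obtain ⟨k, hk, hkB⟩ := T.a_mem _ h
    by_cases hkA : T.deg 0 k ∈ A
    · by_cases hxk : x k = 0
      · simp [hcut, hxk] at hk
      · exact hσ.2 (hup _ hkA _ hσ.1 (hx k hxk))
    · simp [hcut, hkB, hkA] at hk
  let inst : ∀ i, Fintype (coneι R.ι T.ι i) := fun i ↦ match i with
    | 0 => inferInstanceAs (Fintype (T.ι 0))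
    | i + 1 => inferInstanceAs (Fintype (T.ι (i + 1) ⊕ R.ι i))
  let U : StrandResolution K (B \ A) :=
    { ι := coneι R.ι T.ι
      fintype := inst
      decidableEq := fun i ↦ Classical.decEq _
      deg := coneDeg R.deg T.deg
      d := d
      a := T.a ∘ₗ cut
      d_strict := by
        rintro (_ | i) x l hl
        · rw [hd₀] at hl
          by_cases h : T.d 0 (x ∘ Sum.inl) l = 0
          · obtain ⟨k, hk, hlk⟩ := hfs 0 (x ∘ Sum.inr) l fun h' ↦ hl (by simp [h, h'])
            exact ⟨Sum.inr k, hk, hlk⟩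
          · obtain ⟨k, hk, hlk⟩ := T.d_strict 0 _ l h
            exact ⟨Sum.inl k, hk, hlk⟩
        · rw [hd] at hl
          rcases l with l | l
          · by_cases h : T.d (i + 1) (x ∘ Sum.inl) l = 0
            · obtain ⟨k, hk, hlk⟩ := hfs (i + 1) (x ∘ Sum.inr) l fun h' ↦ hl (by simp [h, h'])
              exact ⟨Sum.inr k, hk, hlk⟩
            · obtain ⟨k, hk, hlk⟩ := T.d_strict (i + 1) _ l h
              exact ⟨Sum.inl k, hk, hlk⟩
          · obtain ⟨k, hk, hlk⟩ := R.d_strict i (x ∘ Sum.inr) l fun h ↦ hl (by simp [h])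
            exact ⟨Sum.inr k, hk, hlk⟩
      a_mem := by
        intro x hx
        obtain ⟨k, hk, -⟩ := T.a_mem _ hx
        rw [hcut] at hk
        by_cases h : T.deg 0 k ∈ B \ A
        · exact ⟨k, by simpa [h] using hk, h⟩
        · simp [h] at hk
      a_surj := by
        intro σ hσ
        obtain ⟨x, hx, hax⟩ := T.a_surj σ hσ.1
        exact ⟨x, hx, (hacut σ hσ x hx).trans hax⟩
      exact_zero := by
        intro σ z hz
        constructor
        · rintro ⟨x, hx, rfl⟩ hσ
          obtain ⟨hx₁, hx₂⟩ := mem_strand_sum.1 hx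
          refine (hacut σ hσ _ hz).trans ?_
          rw [hd₀, map_add, haf', T.a_d_eq_zero hσ.1 hx₁, R.a_eq_zero hup hσ.1 hσ.2 hx₂, add_zero]
        · intro h
          -- In a degree of `A` the quotient vanishes, so `z` must be a boundary: its class comes
          -- from `A`, and subtracting the image of a lift to `R` leaves a boundary of `T`.
          by_cases hA : σ ∈ A
          · obtain ⟨y, hy, hay⟩ := R.a_surj σ hA
            have hy' := Submodule.smul_mem _ (T.a z) hy
            obtain ⟨x, hx, hxz⟩ := (T.exact_zero σ _
              (Submodule.sub_mem _ hz ((hf 0).mem_strand hy'))).2 fun _ ↦ by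
                rw [map_sub, haf', map_smul, hay, smul_eq_mul, mul_one, sub_self]
            refine ⟨Sum.elim x (T.a z • y), sumElim_mem_strand.2 ⟨hx, hy'⟩, ?_⟩
            rw [hd₀, Sum.elim_comp_inl, Sum.elim_comp_inr, hxz, sub_add_cancel]
          · obtain ⟨x, hx, hxz⟩ := (T.exact_zero σ z hz).2 fun hB ↦
              (hacut σ ⟨hB, hA⟩ z hz).symm.trans (h ⟨hB, hA⟩)
            refine ⟨Sum.elim x 0, sumElim_mem_strand.2 ⟨hx, zero_mem _⟩, ?_⟩
            rw [hd₀, Sum.elim_comp_inl, Sum.elim_comp_inr, hxz, map_zero, add_zero]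
      exact_succ := by
        -- If the second coordinate of a cycle is a boundary d y, then x + f y is a cycle of `T`,
        -- hence d x'; the required preimage is (x', -y). The two cases below differ only in why the
        -- second coordinate is a boundary.
        have main : ∀ i σ, ∀ x ∈ strand K (T.deg (i + 1)) σ, ∀ y ∈ strand K (R.deg i) σ,
            (∃ y' ∈ strand K (R.deg (i + 1)) σ, R.d i y' = y) →
            T.d i x + f i y = 0 → ∃ z ∈ strand K (Sum.elim (T.deg (i + 2)) (R.deg (i + 1))) σ,
              d (i + 1) z = Sum.elim x y := by
          rintro i σ x hx _ - ⟨y, hy, rfl⟩ h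
          obtain ⟨x', hx', hxx'⟩ := (T.exact_succ i σ _
            (Submodule.add_mem _ hx ((hf (i + 1)).mem_strand hy))).2 (by rw [map_add, hdf', h])
          refine ⟨Sum.elim x' (-y), sumElim_mem_strand.2 ⟨hx', neg_mem hy⟩, ?_⟩
          rw [hd, Sum.elim_comp_inl, Sum.elim_comp_inr, hxx', map_neg, map_neg, neg_neg,
            add_neg_cancel_right]
        rintro (_ | i) σ z hz
        · obtain ⟨hz₁, hz₂⟩ := mem_strand_sum.1 hz
          constructor
          · rintro ⟨y, -, rfl⟩
            rw [hd₀, hd, Sum.elim_comp_inl, Sum.elim_comp_inr, map_add, hdd, hdf', map_neg]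
            simp
          · intro h
            rw [hd₀] at h
            rw [← Sum.elim_comp_inl_inr z]
            refine main 0 σ _ hz₁ _ hz₂ ((R.exact_zero σ _ hz₂).2 fun hA ↦ ?_) h
            have := congrArg T.a h
            rwa [map_add, T.a_d_eq_zero (hAB hA) hz₁, haf', zero_add, map_zero] at this
        · obtain ⟨hz₁, hz₂⟩ := mem_strand_sum.1 hz
          constructor
          · rintro ⟨y, -, rfl⟩
            rw [hd, hd, Sum.elim_comp_inl, Sum.elim_comp_inr, map_add, hdd, hdf', map_neg, map_neg,
              hdd']
            ext (k | k) <;> simp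
          · intro h
            rw [hd] at h
            rw [← Sum.elim_comp_inl_inr z]
            have h₁ := congrArg (· ∘ Sum.inl) h
            have h₂ := congrArg (· ∘ Sum.inr) h
            simp only [Sum.elim_comp_inl, Sum.elim_comp_inr] at h₁ h₂
            exact main (i + 1) σ _ hz₁ _ hz₂ ((R.exact_succ i σ _ hz₂).2 (neg_eq_zero.1 h₂)) h₁ }
  exact ⟨U, fun h ↦ h, rfl, fun i ↦ Set.Sum.elim_range _ _⟩

/-- The shift of a resolution by an order embedding `s` of the degrees whose image is an upper
set of the form `{σ | τ ≤ σ}`. -/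
def shift (R : StrandResolution K C) {E : Type*} [PartialOrder E] (s : D ↪o E)
    (hs : ∀ σ, (∃ τ, s τ = σ) ∨ ∀ τ, ¬ s τ ≤ σ) : StrandResolution K (s '' C) :=
  have hst : ∀ i τ, strand K (fun k ↦ s (R.deg i k)) (s τ) = strand K (R.deg i) τ := fun i τ ↦ by
    ext x
    simp [mem_strand]
  have hst' : ∀ i σ, (∀ τ, ¬ s τ ≤ σ) → ∀ x ∈ strand K (fun k ↦ s (R.deg i k)) σ, x = 0 := by
    intro i σ hσ x hx
    ext k
    by_contra h
    exact hσ _ (hx k h)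
  { ι := R.ι
    deg := fun i k ↦ s (R.deg i k)
    d := R.d
    a := R.a
    d_strict := fun i x l hl ↦ by simpa using R.d_strict i x l hl
    a_mem := fun x hx ↦ by simpa using R.a_mem x hx
    a_surj := by
      rintro _ ⟨τ, hτ, rfl⟩
      rw [hst]
      exact R.a_surj τ hτ
    exact_zero := by
      intro σ x hx
      rcases hs σ with ⟨τ, rfl⟩ | h
      · rw [hst] at hx ⊢
        rw [R.exact_zero τ x hx, s.injective.mem_set_image]
      · obtain rfl := hst' _ _ h x hx
        exact ⟨fun _ _ ↦ map_zero _, fun _ ↦ ⟨0, zero_mem _, map_zero _⟩⟩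
    exact_succ := by
      intro i σ x hx
      rcases hs σ with ⟨τ, rfl⟩ | h
      · rw [hst] at hx ⊢
        exact R.exact_succ i τ x hx
      · obtain rfl := hst' _ _ h x hx
        exact ⟨fun _ ↦ map_zero _, fun _ ↦ ⟨0, zero_mem _, map_zero _⟩⟩ }

/-- The resolution of an ideal obtained from that of the quotient by it. -/
theorem exists_syzygy [OrderBot D] (R : StrandResolution K C) (hR : R.IsCyclic) :
    ∃ T : StrandResolution K Cᶜ, ∀ i, T.degrees i = R.degrees (i + 1) := by
  obtain ⟨⟨_⟩, h₀⟩ := hR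
  have hmem : ∀ x σ, x ∈ strand K (R.deg 0) σ := fun x σ k _ ↦ h₀ k ▸ bot_le
  -- F₀ has rank one, so the augmentation is injective once it is nonzero.
  have hinj : ∀ σ ∈ C, ∀ x : R.ι 0 → K, R.a x = 0 → x = 0 := by
    intro σ hσ x hx
    obtain ⟨y, -, hy⟩ := R.a_surj σ hσ
    have h1 : ∀ z : R.ι 0 → K, z = z default • Pi.single default 1 := fun z ↦ by
      ext k
      simp [Unique.eq_default k]
    rw [h1 x, map_smul, smul_eq_mul] at hx
    rw [h1 y, map_smul, smul_eq_mul] at hy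
    rcases mul_eq_zero.1 hx with h | h
    · ext k
      rw [Unique.eq_default k, h, Pi.zero_apply]
    · simp [h] at hy
  let T : StrandResolution K Cᶜ :=
  { ι := fun i ↦ R.ι (i + 1)
    fintype := fun i ↦ R.fintype (i + 1)
    decidableEq := fun i ↦ R.decidableEq (i + 1)
    deg := fun i ↦ R.deg (i + 1)
    d := fun i ↦ R.d (i + 1)
    -- The only coordinate identifies every strand of F₀ with K, so the ideal inside F₀ is the copy
    -- of K in the degrees outside `C`.
    a := LinearMap.proj default ∘ₗ R.d 0
    d_strict := fun i ↦ R.d_strict (i + 1)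
    a_mem := by
      intro x hx
      by_contra! h
      refine hx ?_
      rw [linearMap_apply_eq_sum_single (LinearMap.proj default ∘ₗ R.d 0) x]
      refine Finset.sum_eq_zero fun k _ ↦ ?_
      by_cases hk : x k = 0
      · simp [hk]
      · have hC : R.deg 1 k ∈ C := by simpa using h k hk
        have := R.a_d_eq_zero hC (single_mem_strand le_rfl 1)
        simp [hinj _ hC _ this]
    a_surj := by
      intro σ hσ
      obtain ⟨y, hy, hdy⟩ := (R.exact_zero σ (Pi.single default 1) (hmem _ _)).2 fun h ↦
        (hσ h).elim
      exact ⟨y, hy, by simp [hdy]⟩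
    exact_zero := by
      intro σ x hx
      rw [R.exact_succ 0 σ x hx]
      constructor
      · intro h _
        simp [h]
      · intro h
        by_cases hσ : σ ∈ C
        · exact hinj σ hσ _ (R.a_d_eq_zero hσ hx)
        · ext k
          rw [Unique.eq_default k]
          exact h hσ
    exact_succ := fun i ↦ R.exact_succ (i + 1) }
  exact ⟨T, fun _ ↦ rfl⟩

theorem degrees_shift (R : StrandResolution K C) {E : Type*} [PartialOrder E] (s : D ↪o E)
    (hs : ∀ σ, (∃ τ, s τ = σ) ∨ ∀ τ, ¬ s τ ≤ σ) (i : ℕ) :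
    (R.shift s hs).degrees i = s '' R.degrees i :=
  Set.range_comp s (R.deg i)

/-- The resolution of a free module of rank one. -/
noncomputable def free [OrderBot D] : StrandResolution K (Set.univ : Set D) where
  ι i := match i with
    | 0 => Unit
    | _ + 1 => Empty
  fintype i := match i with
    | 0 => inferInstanceAs (Fintype Unit)
    | _ + 1 => inferInstanceAs (Fintype Empty)
  decidableEq i := Classical.decEq _
  deg i _ := ⊥
  d i := 0
  a := LinearMap.proj ()
  d_strict i x l hl := (hl rfl).elim
  a_mem x hx := ⟨(), hx, trivial⟩
  a_surj σ _ := ⟨fun _ ↦ 1, fun _ _ ↦ bot_le, rfl⟩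
  exact_zero σ x hx := by
    constructor
    · rintro ⟨y, -, rfl⟩ _
      rfl
    · intro h
      refine ⟨0, zero_mem _, ?_⟩
      ext k
      exact (h trivial).symm
  exact_succ i σ x hx := ⟨fun _ ↦ rfl, fun _ ↦ ⟨0, zero_mem _, funext fun k ↦ k.elim⟩⟩

theorem isCyclic_free [OrderBot D] : (free : StrandResolution K (Set.univ : Set D)).IsCyclic :=
  ⟨⟨inferInstanceAs (Unique Unit)⟩, fun _ ↦ rfl⟩

theorem degrees_free_succ [OrderBot D] (i : ℕ) :
    (free : StrandResolution K (Set.univ : Set D)).degrees (i + 1) = ∅ :=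
  Set.range_eq_empty_iff.2 (inferInstanceAs (IsEmpty Empty))

end StrandResolution

end EdgeIdeal

/-! ### Dirac's theorem: simplicial vertices of chordal graphs. -/

namespace EdgeIdeal

section Chordal

variable {V : Type*}

/-- A shortest path is induced: an edge between two non-consecutive vertices would be a shortcut. -/
theorem adj_mem_edges_of_length_eq_dist {H : SimpleGraph V} {x y u w : V} {p : H.Walk x y}
    (hp : p.length = H.dist x y) (hu : u ∈ p.support) (hw : w ∈ p.support) (huw : H.Adj u w) :
    s(u, w) ∈ p.edges := by
  obtain ⟨i, rfl, hi⟩ := SimpleGraph.Walk.mem_support_iff_exists_getVert.1 hu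
  obtain ⟨j, rfl, hj⟩ := SimpleGraph.Walk.mem_support_iff_exists_getVert.1 hw
  have key : ∀ i j, i < j → j ≤ p.length → H.Adj (p.getVert i) (p.getVert j) →
      s(p.getVert i, p.getVert j) ∈ p.edges := by
    intro i j hij hj hadj
    have h := SimpleGraph.dist_le (((p.take i).concat hadj).append (p.drop j))
    simp only [SimpleGraph.Walk.length_append, SimpleGraph.Walk.length_concat,
      SimpleGraph.Walk.take_length, SimpleGraph.Walk.drop_length] at h
    obtain rfl : j = i + 1 := by omega
    exact (SimpleGraph.Walk.mk_mem_edges_iff_exists p).2 ⟨i, by omega, rfl⟩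
  rcases lt_trichotomy i j with h | rfl | h
  · exact key i j h hj huw
  · exact (huw.ne rfl).elim
  · rw [Sym2.eq_swap]
    exact key j i h hi huw.symm

/-- The graph with the edges of `H` between vertices of `T`. -/
def restrict (H : SimpleGraph V) (T : Set V) : SimpleGraph V where
  Adj u w := H.Adj u w ∧ u ∈ T ∧ w ∈ T
  symm := ⟨fun _ _ h ↦ ⟨h.1.symm, h.2.2, h.2.1⟩⟩
  loopless := ⟨fun _ h ↦ h.1.ne rfl⟩

theorem restrict_mono (H : SimpleGraph V) {T T' : Set V} (h : T ⊆ T') :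
    restrict H T ≤ restrict H T' :=
  fun _ _ h' ↦ ⟨h'.1, h h'.2.1, h h'.2.2⟩

theorem restrict_le (H : SimpleGraph V) (T : Set V) : restrict H T ≤ H := fun _ _ h ↦ h.1

theorem mem_of_mem_support_restrict {H : SimpleGraph V} {T : Set V} {x y : V}
    (p : (restrict H T).Walk x y) (hx : x ∈ T) {z : V} (hz : z ∈ p.support) : z ∈ T := by
  induction p with
  | nil => simp_all
  | cons h p ih =>
    rw [SimpleGraph.Walk.support_cons, List.mem_cons] at hz
    rcases hz with rfl | hz
    · exact hx
    · exact ih h.2.2 hz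

/-- In a chordal graph, two neighbours of `a` which are joined by a path with all inner vertices
outside the closed neighbourhood of `a` are adjacent. -/
theorem IsChordal.adj_of_reachable {H : SimpleGraph V} (hH : IsChordal H) {a x y : V}
    (hax : H.Adj a x) (hay : H.Adj a y) (hxy : x ≠ y) {T : Set V} (hT : ∀ z ∈ T, ¬ H.Adj a z)
    (haT : a ∉ T) (hr : (restrict H (insert x (insert y T))).Reachable x y) : H.Adj x y := by
  by_contra hnxy
  -- A shortest such path, closed up through `a`, is a cycle of length at least 4. It has no chord
  -- at `a`, because inner vertices avoid the neighbours of `a`, and none elsewhere, because the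
  -- path is shortest.
  obtain ⟨p, hp⟩ := hr.exists_walk_length_eq_dist
  have hpT : ∀ z ∈ p.support, z ∈ insert x (insert y T) := fun z hz ↦
    mem_of_mem_support_restrict p (by simp) hz
  have ha : a ∉ p.support := fun h ↦ by
    rcases hpT a h with rfl | rfl | h
    · exact hax.ne rfl
    · exact hay.ne rfl
    · exact haT h
  have hlen : 2 ≤ p.length := by
    by_contra! h
    interval_cases h' : p.length
    · exact hxy (SimpleGraph.Walk.eq_of_length_eq_zero h')
    · exact hnxy (SimpleGraph.Walk.adj_of_length_eq_one h').1
  have hpath : p.IsPath := SimpleGraph.Walk.isPath_of_length_eq_dist p hp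
  let q : H.Walk x y := p.mapLe (restrict_le H _)
  have hqs : q.support = p.support := by simp [q]
  have hqe : q.edges = p.edges := by simp [q]
  have hql : q.length = p.length := by simp [q]
  have hq : q.IsPath := by simpa [q] using hpath
  let c : H.Walk a a := SimpleGraph.Walk.cons hax (q.concat hay.symm)
  have hc : c.IsCycle := by
    rw [SimpleGraph.Walk.cons_isCycle_iff]
    refine ⟨hq.concat (hqs ▸ ha) hay.symm, fun h ↦ ?_⟩
    rw [SimpleGraph.Walk.edges_concat, List.concat_eq_append, List.mem_append,
      List.mem_singleton] at h
    rcases h with h | h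
    · exact ha (hqs ▸ SimpleGraph.Walk.fst_mem_support_of_mem_edges q h)
    · rw [Sym2.eq_swap, Sym2.congr_left] at h
      exact hxy h
  have hcs : ∀ z, z ∈ c.support ↔ z = a ∨ z ∈ p.support := fun z ↦ by
    simp [c, SimpleGraph.Walk.support_concat, hqs]
    tauto
  have hce : ∀ e, e ∈ c.edges ↔ e = s(a, x) ∨ e ∈ p.edges ∨ e = s(y, a) := fun e ↦ by
    simp [c, SimpleGraph.Walk.edges_concat, hqe]
  obtain ⟨u, hu, w, hw, huw, he⟩ := hH a c hc (by
    simp only [c, SimpleGraph.Walk.length_cons, SimpleGraph.Walk.length_concat, hql]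
    omega)
  have key : ∀ z ∈ p.support, H.Adj a z → s(a, z) ∈ c.edges := by
    intro z hz haz
    rw [hce]
    rcases hpT z hz with rfl | rfl | h
    · exact .inl rfl
    · exact .inr (.inr Sym2.eq_swap)
    · exact (hT z h haz).elim
  rw [hcs] at hu hw
  rcases hu with rfl | hu <;> rcases hw with rfl | hw
  · exact huw.ne rfl
  · exact he (key w hw huw)
  · exact he (Sym2.eq_swap ▸ key u hu huw.symm)
  · exact he ((hce _).2 (.inr (.inl (adj_mem_edges_of_length_eq_dist hp hu hw
      ⟨huw, hpT u hu, hpT w hw⟩))))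

/-- The neighbours of `z` in `W` are pairwise adjacent. -/
def IsSimplicial (H : SimpleGraph V) (W : Set V) (z : V) : Prop :=
  ∀ x ∈ W, ∀ y ∈ W, H.Adj z x → H.Adj z y → x ≠ y → H.Adj x y

/-- Dirac's argument. Prescribing a vertex `a` which the simplicial vertex must avoid makes the
induction work. Let `B` be the component of `b` among the non-neighbours of `a`, and let `U` add to
`B` its boundary, which consists of neighbours of `a`. The boundary is a clique by chordality. All
neighbours in `W` of a vertex of `B` lie in `U`, so a vertex of `B` simplicial in `U` is simplicial
in `W`. -/
theorem IsChordal.exists_simplicial_not_adj {H : SimpleGraph V} (hH : IsChordal H)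
    (W : Finset V) : ∀ a ∈ W, ∀ b ∈ W, b ≠ a → ¬ H.Adj a b →
      ∃ z ∈ W, z ≠ a ∧ ¬ H.Adj a z ∧ IsSimplicial H W z := by
  classical
  induction W using Finset.strongInduction with
  | H W ih =>
    intro a ha b hb hba hab
    let T : Set V := {z | z ∈ W ∧ z ≠ a ∧ ¬ H.Adj a z}
    let B : Set V := {z | (restrict H T).Reachable b z}
    have hbT : b ∈ T := ⟨hb, hba, hab⟩
    have hBT : B ⊆ T := by
      rintro z ⟨p⟩
      exact mem_of_mem_support_restrict p hbT p.end_mem_support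
    have hB : ∀ z ∈ B, ∀ x ∈ W, H.Adj z x → x ∈ B ∨ H.Adj a x := by
      intro z hz x hx hzx
      by_cases hax : H.Adj a x
      · exact .inr hax
      · have hxa : x ≠ a := by
          rintro rfl
          exact (hBT hz).2.2 hzx.symm
        exact .inl (hz.trans (SimpleGraph.Adj.reachable ⟨hzx, hBT hz, hx, hxa, hax⟩))
    let U : Finset V := {x ∈ W | x ∈ B ∨ H.Adj a x ∧ ∃ z ∈ B, H.Adj z x}
    have hUW : U ⊂ W := by
      refine Finset.filter_ssubset.2 ⟨a, ha, ?_⟩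
      rintro (h | h)
      · exact (hBT h).2.1 rfl
      · exact h.1.ne rfl
    have hBU : ∀ z ∈ B, z ∈ U := fun z hz ↦ Finset.mem_filter.2 ⟨(hBT hz).1, .inl hz⟩
    have hclique : ∀ x ∈ U, x ∉ B → ∀ y ∈ U, y ∉ B → x ≠ y → H.Adj x y := by
      intro x hx hxB y hy hyB hxy
      obtain ⟨hax, z, hz, hzx⟩ := (Finset.mem_filter.1 hx).2.resolve_left hxB
      obtain ⟨hay, w, hw, hwy⟩ := (Finset.mem_filter.1 hy).2.resolve_left hyB
      refine hH.adj_of_reachable hax hay hxy (T := T) (fun z hz ↦ hz.2.2) (fun h ↦ h.2.1 rfl) ?_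
      have hzw : (restrict H (insert x (insert y T))).Reachable z w :=
        (hz.symm.trans hw).mono (restrict_mono H fun t ht ↦ .inr (.inr ht))
      refine (SimpleGraph.Adj.reachable ?_).trans (hzw.trans (SimpleGraph.Adj.reachable ?_))
      · exact ⟨hzx.symm, .inl rfl, .inr (.inr (hBT hz))⟩
      · exact ⟨hwy, .inr (.inr (hBT hw)), .inr (.inl rfl)⟩
    have hlift : ∀ z ∈ B, IsSimplicial H U z → IsSimplicial H W z := by
      intro z hz hs x hx y hy hzx hzy
      have hU : ∀ x ∈ W, H.Adj z x → x ∈ U := fun x hx hzx ↦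
        Finset.mem_filter.2 ⟨hx, (hB z hz x hx hzx).imp_right fun h ↦ ⟨h, z, hz, hzx⟩⟩
      exact hs x (hU x hx hzx) y (hU y hy hzy) hzx hzy
    suffices h : ∃ z ∈ B, IsSimplicial H U z by
      obtain ⟨z, hz, hs⟩ := h
      exact ⟨z, (hBT hz).1, (hBT hz).2.1, (hBT hz).2.2, hlift z hz hs⟩
    -- The induction hypothesis must return a vertex of `B`. If some boundary vertex has a
    -- non-neighbour, use it as the vertex to avoid: the boundary is a clique. Otherwise boundary
    -- vertices are adjacent to all of `U`, so any non-adjacent pair serves; if there is none, `U`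
    -- is a clique and `b` itself works.
    by_cases h₁ : ∃ x ∈ U, x ∉ B ∧ ∃ y ∈ U, y ≠ x ∧ ¬ H.Adj x y
    · obtain ⟨x, hx, hxB, y, hy, hyx, hxy⟩ := h₁
      obtain ⟨z, hz, hzx, hxz, hs⟩ := ih U hUW x hx y hy hyx hxy
      refine ⟨z, ?_, hs⟩
      by_contra hzB
      exact hxz (hclique x hx hxB z hz hzB hzx.symm)
    · push Not at h₁
      by_cases h₂ : ∃ x ∈ U, ∃ y ∈ U, y ≠ x ∧ ¬ H.Adj x y
      · obtain ⟨x, hx, y, hy, hyx, hxy⟩ := h₂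
        obtain ⟨z, hz, hzx, hxz, hs⟩ := ih U hUW x hx y hy hyx hxy
        refine ⟨z, ?_, hs⟩
        by_contra hzB
        exact hxz (h₁ z hz hzB x hx hzx.symm).symm
      · push Not at h₂
        exact ⟨b, SimpleGraph.Reachable.refl b, fun x hx y hy _ _ hxy ↦ h₂ x hx y hy hxy.symm⟩

theorem IsChordal.exists_simplicial {H : SimpleGraph V} (hH : IsChordal H) {W : Finset V}
    (hW : W.Nonempty) : ∃ z ∈ W, IsSimplicial H W z := by
  by_cases h : ∃ a ∈ W, ∃ b ∈ W, b ≠ a ∧ ¬ H.Adj a b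
  · obtain ⟨a, ha, b, hb, hba, hab⟩ := h
    obtain ⟨z, hz, -, -, hs⟩ := hH.exists_simplicial_not_adj W a ha b hb hba hab
    exact ⟨z, hz, hs⟩
  · push Not at h
    obtain ⟨z, hz⟩ := hW
    exact ⟨z, hz, fun x hx y hy _ _ hxy ↦ h x hx y hy hxy.symm⟩

/-- In a co-chordal graph, every nonempty set `W` of vertices contains a vertex whose neighbours
cover all edges between vertices of `W`. -/
theorem IsCochordal.exists_neighbors_cover {G : SimpleGraph V} (hG : IsCochordal G)
    {W : Finset V} (hW : W.Nonempty) :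
    ∃ v ∈ W, ∀ x ∈ W, ∀ y ∈ W, G.Adj x y → G.Adj v x ∨ G.Adj v y := by
  obtain ⟨v, hv, hs⟩ := IsChordal.exists_simplicial hG hW
  refine ⟨v, hv, fun x hx y hy hxy ↦ ?_⟩
  by_contra! h
  have hvx : v ≠ x := by
    rintro rfl
    exact h.2 hxy
  have hvy : v ≠ y := by
    rintro rfl
    exact h.1 hxy.symm
  exact ((SimpleGraph.compl_adj ..).1 (hs x hx y hy ((SimpleGraph.compl_adj ..).2 ⟨hvx, h.1⟩)
    ((SimpleGraph.compl_adj ..).2 ⟨hvy, h.2⟩) hxy.ne)).2 hxy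

end Chordal

end EdgeIdeal

/-! ### The linear resolution obtained by eliminating vertices. -/

namespace EdgeIdeal

open StrandResolution

variable {V K : Type*} [Field K]

/-- Addition of a vertex, as an order embedding of the exponents. -/
noncomputable def addVertex (v : V) : (V →₀ ℕ) ↪o (V →₀ ℕ) :=
  OrderEmbedding.ofMapLEIff (· + Finsupp.single v 1) fun _ _ ↦ add_le_add_iff_right _

theorem addVertex_apply (v : V) (σ : V →₀ ℕ) : addVertex v σ = σ + Finsupp.single v 1 := rfl

theorem addVertex_sub {v : V} {σ : V →₀ ℕ} (h : σ v ≠ 0) :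
    addVertex v (σ - Finsupp.single v 1) = σ :=
  tsub_add_cancel_of_le (by
    rw [Finsupp.single_le_iff]
    omega)

theorem addVertex_cases (v : V) (σ : V →₀ ℕ) :
    (∃ τ, addVertex v τ = σ) ∨ ∀ τ, ¬ addVertex v τ ≤ σ := by
  by_cases h : σ v = 0
  · refine .inr fun τ hτ ↦ ?_
    have := hτ v
    simp [addVertex_apply, h] at this
  · exact .inl ⟨_, addVertex_sub h⟩

theorem addVertex_of_ne {v x : V} (h : x ≠ v) (σ : V →₀ ℕ) : addVertex v σ x = σ x := by
  simp [addVertex_apply, h.symm]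

theorem addVertex_self_ne_zero (v : V) (σ : V →₀ ℕ) : addVertex v σ v ≠ 0 := by
  simp [addVertex_apply]

theorem degree_addVertex (v : V) (σ : V →₀ ℕ) : (addVertex v σ).degree = σ.degree + 1 := by
  simp [addVertex_apply]

/-- The exponents of the monomials outside the ideal generated by the vertices in `N`. -/
def primeCompl (N : Finset V) : Set (V →₀ ℕ) := {σ | ∀ v ∈ N, σ v = 0}

/-- The exponents of the monomials outside the edge ideal of the subgraph of `G` induced
on `W`. -/
def edgeCompl (G : SimpleGraph V) (W : Finset V) : Set (V →₀ ℕ) :=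
  {σ | ∀ x ∈ W, ∀ y ∈ W, G.Adj x y → σ x = 0 ∨ σ y = 0}

theorem isLowerSet_primeCompl (N : Finset V) : IsLowerSet (primeCompl N) :=
  fun _ _ h hσ v hv ↦ Nat.eq_zero_of_le_zero (hσ v hv ▸ h v)

theorem isLowerSet_edgeCompl (G : SimpleGraph V) (W : Finset V) : IsLowerSet (edgeCompl G W) :=
  fun _ _ h hσ x hx y hy hxy ↦ (hσ x hx y hy hxy).imp
    (fun h' ↦ Nat.eq_zero_of_le_zero ((h x).trans_eq h'))
    (fun h' ↦ Nat.eq_zero_of_le_zero ((h y).trans_eq h'))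

variable (K) in
/-- The Koszul resolution. -/
theorem exists_resolution_primeCompl (N : Finset V) :
    ∃ R : StrandResolution K (primeCompl N), R.IsCyclic ∧
      (∀ i, ∀ σ ∈ R.degrees i, σ.degree = i) ∧
      ∀ i, (R.degrees i).Nonempty ↔ i ≤ N.card := by
  classical
  induction N using Finset.induction_on with
  | empty =>
    have : primeCompl (∅ : Finset V) = Set.univ := by simp [primeCompl]
    rw [this]
    refine ⟨free, isCyclic_free, ?_, ?_⟩
    · rintro (_ | i) σ hσ
      · rw [isCyclic_free.degrees_zero] at hσ
        rw [hσ, bot_eq_zero, map_zero]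
      · simp [degrees_free_succ] at hσ
    · rintro (_ | i)
      · simp [isCyclic_free.degrees_zero]
      · simp [degrees_free_succ]
  | insert v N hv ih =>
    obtain ⟨R, hR, hdeg, hne⟩ := ih
    have hmem : ∀ τ, τ ∈ primeCompl N → addVertex v τ ∈ primeCompl N := by
      intro τ hτ x hx
      rw [addVertex_of_ne (by rintro rfl; exact hv hx)]
      exact hτ x hx
    -- S/(N, v) is the cokernel of multiplication by x_v on S/(N). The shifted copy has total degree
    -- i + 1 in place i, against i for the original, so the cone is minimal.
    have hset : primeCompl N \ addVertex v '' primeCompl N = primeCompl (insert v N) := by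
      ext σ
      simp only [primeCompl, Set.mem_sdiff, Finset.forall_mem_insert, Set.mem_ofPred_eq]
      constructor
      · rintro ⟨h, h'⟩
        refine ⟨?_, h⟩
        by_contra hσ
        exact h' ⟨_, isLowerSet_primeCompl N tsub_le_self h, addVertex_sub hσ⟩
      · rintro ⟨h, h'⟩
        refine ⟨h', ?_⟩
        rintro ⟨τ, -, rfl⟩
        exact addVertex_self_ne_zero v τ h
    rw [← hset]
    obtain ⟨U, hU, -, hUd⟩ := exists_cone (R.shift (addVertex v) (addVertex_cases v)) R (by
      rintro _ ⟨τ, hτ, rfl⟩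
      exact hmem τ hτ) (by
      rintro _ ⟨τ, hτ, rfl⟩ σ hσ hle
      rcases addVertex_cases v σ with ⟨ρ, rfl⟩ | h
      · exact ⟨ρ, isLowerSet_primeCompl N (le_add_of_nonneg_right zero_le) hσ, rfl⟩
      · exact (h _ hle).elim) (by
      intro i k l h
      have h₁ := hdeg i _ ⟨k, rfl⟩
      have h₂ := hdeg i _ ⟨l, rfl⟩
      rw [← h] at h₂
      have := (degree_addVertex v (R.deg i k)).symm.trans h₂
      omega)
    refine ⟨U, hU hR, ?_, ?_⟩
    · rintro (_ | i) σ hσ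
      · rw [(hU hR).degrees_zero] at hσ
        rw [hσ, bot_eq_zero, map_zero]
      · rw [hUd, degrees_shift] at hσ
        rcases hσ with hσ | ⟨τ, hτ, rfl⟩
        · exact hdeg _ _ hσ
        · rw [degree_addVertex, hdeg _ _ hτ]
    · rintro (_ | i)
      · simp [(hU hR).degrees_zero]
      · rw [hUd, degrees_shift, Set.union_nonempty, Set.image_nonempty, hne, hne,
          Finset.card_insert_of_notMem hv]
        omega

/-- The subgraph of `G` induced on `W` contains a complete bipartite subgraph with at least `n`
vertices. -/
def HasBipartite (G : SimpleGraph V) (W : Finset V) (n : ℕ) : Prop :=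
  ∃ A B : Finset V, A ⊆ W ∧ B ⊆ W ∧ A.Nonempty ∧ B.Nonempty ∧ (∀ a ∈ A, ∀ b ∈ B, G.Adj a b) ∧
    n ≤ A.card + B.card

/-- The three alternatives match the three contributions to the cone in
`exists_resolution_edgeCompl`. A subgraph using `v` is either a star centred at `v` or stays
bipartite after `v` is deleted. Conversely, `v` can be added to any complete bipartite subgraph of
the rest: if `v` misses some `a ∈ A`, covering the edges at `a` forces `v` to be adjacent to all of
`B`. -/
theorem hasBipartite_iff_erase [DecidableEq V] {G : SimpleGraph V} [DecidableRel G.Adj]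
    {W : Finset V} {v : V} (hv : v ∈ W)
    (hcov : ∀ x ∈ W, ∀ y ∈ W, G.Adj x y → G.Adj v x ∨ G.Adj v y) (i : ℕ) :
    HasBipartite G W (i + 2) ↔ HasBipartite G (W.erase v) (i + 2) ∨
      i + 1 ≤ (W.filter (G.Adj v)).card ∨ ∃ j, i = j + 1 ∧ HasBipartite G (W.erase v) (j + 2) := by
  have hWv : W.erase v ⊆ W := Finset.erase_subset _ _
  constructor
  · have key : ∀ A B : Finset V, A ⊆ W → B ⊆ W → A.Nonempty → B.Nonempty →
        (∀ a ∈ A, ∀ b ∈ B, G.Adj a b) → i + 2 ≤ A.card + B.card → v ∈ A →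
        HasBipartite G (W.erase v) (i + 2) ∨ i + 1 ≤ (W.filter (G.Adj v)).card ∨
          ∃ j, i = j + 1 ∧ HasBipartite G (W.erase v) (j + 2) := by
      intro A B hA hB hA₀ hB₀ hAB hcard hvA
      have hvB : v ∉ B := fun h ↦ (hAB v hvA v h).ne rfl
      have hA' := Finset.card_erase_add_one hvA
      rcases (A.erase v).eq_empty_or_nonempty with h | h
      · refine .inr (.inl ?_)
        have : B.card ≤ (W.filter (G.Adj v)).card := Finset.card_le_card fun b hb ↦
          Finset.mem_filter.2 ⟨hB hb, hAB v hvA b hb⟩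
        rw [h, Finset.card_empty] at hA'
        omega
      · have hbip : HasBipartite G (W.erase v) ((A.erase v).card + B.card) :=
          ⟨A.erase v, B, Finset.erase_subset_erase v hA, Finset.subset_erase.2 ⟨hB, hvB⟩, h, hB₀,
            fun a ha b hb ↦ hAB a (Finset.mem_of_mem_erase ha) b hb, le_rfl⟩
        obtain ⟨A', B', h₁, h₂, h₃, h₄, h₅, h₆⟩ := hbip
        have h₇ := h₃.card_pos
        have h₈ := h₄.card_pos
        rcases i with _ | i
        -- For i = 0 two nonempty sides already have enough vertices, so nothing is lost by deleting
        -- `v`.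
        · exact .inl ⟨A', B', h₁, h₂, h₃, h₄, h₅, by omega⟩
        · exact .inr (.inr ⟨i, rfl, A', B', h₁, h₂, h₃, h₄, h₅, by omega⟩)
    rintro ⟨A, B, hA, hB, hA₀, hB₀, hAB, hcard⟩
    by_cases hvA : v ∈ A
    · exact key A B hA hB hA₀ hB₀ hAB hcard hvA
    by_cases hvB : v ∈ B
    · exact key B A hB hA hB₀ hA₀ (fun b hb a ha ↦ (hAB a ha b hb).symm) (by omega) hvB
    · exact .inl ⟨A, B, Finset.subset_erase.2 ⟨hA, hvA⟩, Finset.subset_erase.2 ⟨hB, hvB⟩, hA₀, hB₀,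
        hAB, hcard⟩
  · rintro (⟨A, B, hA, hB, h⟩ | h | ⟨j, rfl, A, B, hA, hB, hA₀, hB₀, hAB, hcard⟩)
    · exact ⟨A, B, hA.trans hWv, hB.trans hWv, h⟩
    · refine ⟨{v}, W.filter (G.Adj v), by simpa using hv, Finset.filter_subset _ _, by simp,
        Finset.card_pos.1 (by omega), by simp, ?_⟩
      rw [Finset.card_singleton]
      omega
    · have key : ∀ A B : Finset V, A ⊆ W.erase v → B ⊆ W.erase v → A.Nonempty →
          (∀ a ∈ A, ∀ b ∈ B, G.Adj a b) → j + 2 ≤ A.card + B.card → (∀ a ∈ A, G.Adj v a) →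
          HasBipartite G W (j + 1 + 2) := by
        intro A B hA hB hA₀ hAB hcard hvA
        refine ⟨A, insert v B, hA.trans hWv, Finset.insert_subset hv (hB.trans hWv), hA₀,
          Finset.insert_nonempty _ _, fun a ha b hb ↦ ?_, ?_⟩
        · rcases Finset.mem_insert.1 hb with rfl | hb
          · exact (hvA a ha).symm
          · exact hAB a ha b hb
        · rw [Finset.card_insert_of_notMem fun h ↦ by simpa using hB h]
          omega
      by_cases h : ∀ a ∈ A, G.Adj v a
      · exact key A B hA hB hA₀ hAB hcard h
      · push Not at h
        obtain ⟨a, ha, hva⟩ := h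
        exact key B A hB hA hB₀ (fun b hb a ha ↦ (hAB a ha b hb).symm) (by omega) fun b hb ↦
          (hcov a (hWv (hA ha)) b (hWv (hB hb)) (hAB a ha b hb)).resolve_left hva

variable (K) in
/-- If the vertices of `G` can be eliminated one by one, each covering by its neighbours the edges
which are left, then the edge ideal of `G` has a linear resolution, whose length is given by the
complete bipartite subgraphs of `G`. -/
theorem exists_resolution_edgeCompl {G : SimpleGraph V}
    (hG : ∀ W : Finset V, W.Nonempty →
      ∃ v ∈ W, ∀ x ∈ W, ∀ y ∈ W, G.Adj x y → G.Adj v x ∨ G.Adj v y) (W : Finset V) :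
    ∃ R : StrandResolution K (edgeCompl G W), R.IsCyclic ∧
      (∀ i, ∀ σ ∈ R.degrees (i + 1), σ.degree = i + 2) ∧
      ∀ i, (R.degrees (i + 1)).Nonempty ↔ HasBipartite G W (i + 2) := by
  classical
  induction W using Finset.strongInduction with
  | H W ih =>
    rcases W.eq_empty_or_nonempty with rfl | hW
    · have : edgeCompl G ∅ = Set.univ := by simp [edgeCompl]
      rw [this]
      refine ⟨free, isCyclic_free, fun i σ hσ ↦ ?_, fun i ↦ ?_⟩
      · simp [degrees_free_succ] at hσ
      · rw [degrees_free_succ]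
        refine ⟨fun h ↦ by simp at h, ?_⟩
        rintro ⟨A, -, hA, -, ⟨a, ha⟩, -⟩
        simpa using hA ha
    obtain ⟨v, hv, hcov⟩ := hG W hW
    obtain ⟨R, hR, hRdeg, hRne⟩ := ih (W.erase v) (Finset.erase_ssubset hv)
    let N : Finset V := W.filter (G.Adj v)
    obtain ⟨P, hP, hPdeg, hPne⟩ := exists_resolution_primeCompl K N
    obtain ⟨R', hR'⟩ := exists_syzygy R hR
    obtain ⟨P', hP'⟩ := exists_syzygy P hP
    have hWv : W.erase v ⊆ W := Finset.erase_subset _ _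
    -- `Q` resolves P/I(H), where H is induced on `W.erase v`. In place i the ideal I(H) has total
    -- degree i + 2 and P has i + 1. The inclusion I(H) ⊆ P is the covering property of `v`.
    obtain ⟨Q, -, hQ₀, hQ⟩ := exists_cone R' P' (by
      intro σ hσ hσ'
      refine hσ fun x hx y hy hxy ↦ ?_
      exact (hcov x (hWv hx) y (hWv hy) hxy).imp (fun h ↦ hσ' x (Finset.mem_filter.2 ⟨hWv hx, h⟩))
        (fun h ↦ hσ' y (Finset.mem_filter.2 ⟨hWv hy, h⟩)))
      (fun σ hσ τ _ hle ↦ (isLowerSet_edgeCompl G _).compl hle hσ) (by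
      intro i k l h
      have h₁ := hRdeg i (R'.deg i k) (hR' i ▸ ⟨k, rfl⟩)
      have h₂ := hPdeg (i + 1) (P'.deg i l) (hP' i ▸ ⟨l, rfl⟩)
      rw [h, h₂] at h₁
      omega)
    have hQdeg : ∀ i, ∀ σ ∈ Q.degrees i, σ.degree = i + 1 := by
      rintro (_ | i) σ hσ
      · rw [hQ₀, hP'] at hσ
        exact hPdeg _ _ hσ
      · rw [hQ, hP', hR'] at hσ
        rcases hσ with hσ | hσ
        · exact hPdeg _ _ hσ
        · exact hRdeg _ _ hσ
    -- A monomial outside I(H) lies in I(G) exactly when it is x_v times a monomial of P; that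
    -- monomial is then also outside I(H), which is why P/I(H) appears.
    have hset : edgeCompl G (W.erase v) \
        addVertex v '' ((primeCompl N)ᶜ \ (edgeCompl G (W.erase v))ᶜ) = edgeCompl G W := by
      ext σ
      constructor
      · rintro ⟨h, h'⟩
        have hN : ∀ x ∈ W, G.Adj v x → σ v = 0 ∨ σ x = 0 := by
          intro x hx hvx
          by_contra! h₀
          refine h' ⟨_, ⟨fun hP ↦ h₀.2 ?_, not_not.2
            (isLowerSet_edgeCompl _ _ tsub_le_self h)⟩, addVertex_sub h₀.1⟩
          rw [← addVertex_sub h₀.1, addVertex_of_ne hvx.ne']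
          exact hP x (Finset.mem_filter.2 ⟨hx, hvx⟩)
        intro x hx y hy hxy
        by_cases hxv : x = v
        · subst hxv
          exact hN y hy hxy
        by_cases hyv : y = v
        · subst hyv
          exact (hN x hx hxy.symm).symm
        exact h x (Finset.mem_erase.2 ⟨hxv, hx⟩) y (Finset.mem_erase.2 ⟨hyv, hy⟩) hxy
      · intro h
        refine ⟨fun x hx y hy ↦ h x (hWv hx) y (hWv hy), ?_⟩
        rintro ⟨τ, ⟨hτ, -⟩, rfl⟩
        refine hτ fun x hx ↦ ?_
        obtain ⟨hx, hvx⟩ := Finset.mem_filter.1 hx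
        rw [← addVertex_of_ne hvx.ne']
        exact (h v hv x hx hvx).resolve_left (addVertex_self_ne_zero v τ)
    rw [← hset]
    -- Shifted by v, `Q` has total degree i + 2 in place i, while `R` has i + 1 there, or 0 for i =
    -- 0.
    obtain ⟨U, hU, -, hUd⟩ := exists_cone (Q.shift (addVertex v) (addVertex_cases v)) R (by
      rintro _ ⟨τ, ⟨-, hτ⟩, rfl⟩ x hx y hy hxy
      rw [addVertex_of_ne (Finset.ne_of_mem_erase hx), addVertex_of_ne (Finset.ne_of_mem_erase hy)]
      exact not_not.1 hτ x hx y hy hxy) (by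
      rintro _ ⟨τ, ⟨hτ, -⟩, rfl⟩ σ hσ hle
      rcases addVertex_cases v σ with ⟨ρ, rfl⟩ | h
      · exact ⟨ρ, ⟨(isLowerSet_primeCompl N).compl ((addVertex v).le_iff_le.1 hle) hτ,
          not_not.2 (isLowerSet_edgeCompl _ _ (le_add_of_nonneg_right zero_le) hσ)⟩, rfl⟩
      · exact (h _ hle).elim) (by
      intro i k l h
      have h₁ := (degree_addVertex v (Q.deg i k)).trans (congrArg (· + 1) (hQdeg i _ ⟨k, rfl⟩))
      replace h₁ : (R.deg i l).degree = _ := (congrArg _ h.symm).trans h₁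
      rcases i with _ | i
      · simp [hR.2, bot_eq_zero] at h₁
      · rw [hRdeg i _ ⟨l, rfl⟩] at h₁
        omega)
    refine ⟨U, hU hR, fun i σ hσ ↦ ?_, fun i ↦ ?_⟩
    · rw [hUd, degrees_shift] at hσ
      rcases hσ with hσ | ⟨τ, hτ, rfl⟩
      · exact hRdeg _ _ hσ
      · rw [degree_addVertex, hQdeg _ _ hτ]
    · rw [hUd, degrees_shift, Set.union_nonempty, Set.image_nonempty, hRne,
        hasBipartite_iff_erase hv hcov]
      refine or_congr_right ?_
      rcases i with _ | i
      · rw [hQ₀, hP', hPne]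
        simp [N]
      · rw [hQ, hP', hR', Set.union_nonempty, hPne, hRne]
        simp [N]

end EdgeIdeal

/-! ### Passage between strands and modules over the polynomial ring. -/

namespace EdgeIdeal

open MvPolynomial

section Components

variable {V K : Type*} [Field K]

/-- The component of degree `σ` of an element of a graded free module. -/
noncomputable def component {ι : Type*} (deg : ι → V →₀ ℕ) (σ : V →₀ ℕ)
    (x : ι → MvPolynomial V K) : ι → K := by
  classical
  exact fun l ↦ if deg l ≤ σ then coeff (σ - deg l) (x l) else 0

/-- The homogeneous element of degree `σ` of a graded free module with given coefficients. -/
noncomputable def ofStrand {ι : Type*} (deg : ι → V →₀ ℕ) (σ : V →₀ ℕ)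
    (x : ι → K) : ι → MvPolynomial V K :=
  fun l ↦ monomial (σ - deg l) (x l)

variable {ι κ : Type*} {deg : ι → V →₀ ℕ} {deg' : κ → V →₀ ℕ} {σ τ : V →₀ ℕ}

theorem component_apply_of_le {l : ι} (h : deg l ≤ σ) (x : ι → MvPolynomial V K) :
    component deg σ x l = coeff (σ - deg l) (x l) := if_pos h

theorem component_apply_of_not_le {l : ι} (h : ¬ deg l ≤ σ) (x : ι → MvPolynomial V K) :
    component deg σ x l = 0 := if_neg h

theorem component_mem_strand (x : ι → MvPolynomial V K) :
    component deg σ x ∈ strand K deg σ := fun l hl ↦ by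
  by_contra h
  exact hl (component_apply_of_not_le h x)

theorem component_ofStrand_self {x : ι → K} (hx : x ∈ strand K deg σ) :
    component deg σ (ofStrand deg σ x) = x := by
  classical
  ext l
  by_cases h : deg l ≤ σ
  · simp [component_apply_of_le h, ofStrand, coeff_monomial]
  · rw [component_apply_of_not_le h]
    by_contra h'
    exact h (hx l (Ne.symm h'))

theorem component_ofStrand_of_ne {x : ι → K} (hx : x ∈ strand K deg σ) (h : τ ≠ σ) :
    component deg τ (ofStrand deg σ x) = 0 := by
  classical
  ext l
  by_cases hτ : deg l ≤ τ
  · by_cases hxl : x l = 0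
    · simp [component_apply_of_le hτ, ofStrand, hxl]
    · rw [component_apply_of_le hτ, ofStrand, coeff_monomial, if_neg, Pi.zero_apply]
      exact fun h' ↦ h ((tsub_left_inj hτ (hx l hxl)).1 h'.symm)
  · exact component_apply_of_not_le hτ _

theorem component_sum {α : Type*} (T : Finset α) (x : α → ι → MvPolynomial V K) :
    component deg σ (∑ t ∈ T, x t) = ∑ t ∈ T, component deg σ (x t) := by
  ext l
  rw [Finset.sum_apply]
  by_cases h : deg l ≤ σ
  · simp [component_apply_of_le h, coeff_sum]
  · simp [component_apply_of_not_le h]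

theorem component_ext {x y : ι → MvPolynomial V K}
    (h : ∀ σ, component deg σ x = component deg σ y) : x = y := by
  ext l m
  have := congrFun (h (m + deg l)) l
  have hle : deg l ≤ m + deg l := le_add_of_nonneg_left zero_le
  simpa [component_apply_of_le hle] using this

theorem component_zero : component deg σ (0 : ι → MvPolynomial V K) = 0 := by
  ext l
  by_cases h : deg l ≤ σ
  · simp [component_apply_of_le h]
  · simp [component_apply_of_not_le h]

theorem exists_finset_component [Fintype ι] (deg : ι → V →₀ ℕ) (x : ι → MvPolynomial V K) :
    ∃ T : Finset (V →₀ ℕ), ∀ σ ∉ T, component deg σ x = 0 := by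
  classical
  refine ⟨Finset.univ.biUnion fun l ↦ (x l).support.image (· + deg l), fun σ hσ ↦ ?_⟩
  ext l
  by_contra h
  have hle := component_mem_strand (σ := σ) x l h
  rw [component_apply_of_le hle] at h
  exact hσ (Finset.mem_biUnion.2 ⟨l, Finset.mem_univ l,
    Finset.mem_image.2 ⟨_, mem_support_iff.2 h, tsub_add_cancel_of_le hle⟩⟩)

/-- A homogeneous linear map acts on components by its scalar matrix. -/
theorem component_linearMap_apply [Fintype κ] [DecidableEq κ]
    {f : (κ → MvPolynomial V K) →ₗ[MvPolynomial V K] (ι → MvPolynomial V K)}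
    {c : (κ → K) →ₗ[K] (ι → K)} (hc : ∀ k l, c (Pi.single k 1) l ≠ 0 → deg l ≤ deg' k)
    (hf : ∀ k l, f (Pi.single k 1) l = monomial (deg' k - deg l) (c (Pi.single k 1) l))
    (σ : V →₀ ℕ) (x : κ → MvPolynomial V K) :
    component deg σ (f x) = c (component deg' σ x) := by
  ext l
  rw [pi_apply_eq_sum_single c]
  by_cases hl : deg l ≤ σ
  · rw [component_apply_of_le hl, pi_apply_eq_sum_single f, coeff_sum]
    refine Finset.sum_congr rfl fun k _ ↦ ?_
    rw [hf, coeff_mul_monomial']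
    by_cases h0 : c (Pi.single k 1) l = 0
    · simp [h0]
    have hk := hc k l h0
    by_cases hkσ : deg' k ≤ σ
    · rw [if_pos (tsub_le_tsub_right hkσ _), component_apply_of_le hkσ,
        tsub_tsub_tsub_cancel_right hk]
    · rw [if_neg fun h ↦ hkσ ((tsub_le_tsub_iff_right hl).1 h), component_apply_of_not_le hkσ,
        zero_mul]
  · rw [component_apply_of_not_le hl]
    symm
    refine Finset.sum_eq_zero fun k _ ↦ ?_
    by_cases h0 : c (Pi.single k 1) l = 0
    · simp [h0]
    · rw [component_apply_of_not_le fun h ↦ hl ((hc k l h0).trans h), zero_mul]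

/-- The image of a homogeneous map is described by homogeneous conditions if and only if this
holds in each degree. -/
theorem forall_mem_range_iff [Fintype ι]
    {f : (κ → MvPolynomial V K) →ₗ[MvPolynomial V K] (ι → MvPolynomial V K)}
    {c : (κ → K) →ₗ[K] (ι → K)}
    (hf : ∀ σ x, component deg σ (f x) = c (component deg' σ x))
    {Z : (ι → MvPolynomial V K) → Prop} {z : (V →₀ ℕ) → (ι → K) → Prop}
    (hZ : ∀ x, Z x ↔ ∀ σ, z σ (component deg σ x)) (hz : ∀ τ, z τ 0) :
    (∀ x, Z x ↔ ∃ y, f y = x) ↔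
      ∀ σ, ∀ x ∈ strand K deg σ, (∃ y ∈ strand K deg' σ, c y = x) ↔ z σ x := by
  constructor
  · intro h σ x hx
    constructor
    · rintro ⟨y, hy, rfl⟩
      have := (hZ _).1 ((h (f (ofStrand deg' σ y))).2 ⟨_, rfl⟩) σ
      rwa [hf, component_ofStrand_self hy] at this
    · intro hzx
      obtain ⟨y, hy⟩ := (h (ofStrand deg σ x)).1 ((hZ _).2 fun τ ↦ by
        by_cases hτ : τ = σ
        · rwa [hτ, component_ofStrand_self hx]
        · rw [component_ofStrand_of_ne hx hτ]
          exact hz τ)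
      exact ⟨component deg' σ y, component_mem_strand y, by
        rw [← hf, hy, component_ofStrand_self hx]⟩
  · intro h x
    constructor
    · intro hx
      choose y hy hcy using fun σ ↦ (h σ _ (component_mem_strand x)).2 ((hZ x).1 hx σ)
      -- Only finitely many components are nonzero, so the preimages found degree by degree can be
      -- summed.
      obtain ⟨T, hT⟩ := exists_finset_component deg x
      refine ⟨∑ σ ∈ T, ofStrand deg' σ (y σ), component_ext (deg := deg) fun τ ↦ ?_⟩
      rw [hf, component_sum, map_sum]
      by_cases hτ : τ ∈ T
      · rw [Finset.sum_eq_single_of_mem τ hτ, component_ofStrand_self (hy τ), hcy]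
        intro σ _ hσ
        rw [component_ofStrand_of_ne (hy σ) hσ.symm, map_zero]
      · rw [hT τ hτ]
        refine Finset.sum_eq_zero fun σ hσ ↦ ?_
        rw [component_ofStrand_of_ne (hy σ) (by rintro rfl; exact hτ hσ), map_zero]
    · rintro ⟨y, rfl⟩
      refine (hZ _).2 fun σ ↦ ?_
      rw [hf]
      exact (h σ _ (hf σ y ▸ component_mem_strand (f y))).1 ⟨_, component_mem_strand y, rfl⟩

theorem eq_zero_iff_component (x : ι → MvPolynomial V K) :
    x = 0 ↔ ∀ σ, component deg σ x = 0 :=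
  ⟨fun h _ ↦ h ▸ component_zero, fun h ↦ component_ext (deg := deg) fun σ ↦
    (h σ).trans component_zero.symm⟩

theorem coeff_eq_apply_component [Fintype ι] [DecidableEq ι]
    {p : (ι → MvPolynomial V K) →ₗ[MvPolynomial V K] MvPolynomial V K} {a : (ι → K) →ₗ[K] K}
    (hp : ∀ k, p (Pi.single k 1) = monomial (deg k) (a (Pi.single k 1)))
    (x : ι → MvPolynomial V K) (σ : V →₀ ℕ) : coeff σ (p x) = a (component deg σ x) := by
  rw [linearMap_apply_eq_sum_single p, linearMap_apply_eq_sum_single a, coeff_sum]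
  refine Finset.sum_congr rfl fun k _ ↦ ?_
  rw [hp, smul_eq_mul, smul_eq_mul, coeff_mul_monomial']
  by_cases hk : deg k ≤ σ
  · rw [if_pos hk, component_apply_of_le hk]
  · rw [if_neg hk, component_apply_of_not_le hk, zero_mul]

end Components

section Comparison

attribute [instance] MinimalFreeResolution.fintype MinimalFreeResolution.decidableEq

variable {V K : Type*} [Field K] {I : Ideal (MvPolynomial V K)} {C : Set (V →₀ ℕ)}

theorem mk_eq_zero_iff_component {ι : Type*} [Fintype ι] [DecidableEq ι] {deg : ι → V →₀ ℕ}
    (hI : ∀ f, f ∈ I ↔ ∀ σ ∈ C, coeff σ f = 0)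
    {p : (ι → MvPolynomial V K) →ₗ[MvPolynomial V K] MvPolynomial V K} {a : (ι → K) →ₗ[K] K}
    (hp : ∀ k, p (Pi.single k 1) = monomial (deg k) (a (Pi.single k 1)))
    (x : ι → MvPolynomial V K) :
    Ideal.Quotient.mk I (p x) = 0 ↔ ∀ σ, σ ∈ C → a (component deg σ x) = 0 := by
  rw [Ideal.Quotient.eq_zero_iff_mem, hI]
  simp only [coeff_eq_apply_component hp]

/-- The minimal free resolution with given strands. -/
theorem StrandResolution.exists_minimalFreeResolution
    (hI : ∀ f, f ∈ I ↔ ∀ σ ∈ C, coeff σ f = 0) (R : StrandResolution K C) :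
    Nonempty (MinimalFreeResolution (quotientGrading I)) := by
  classical
  have hd : ∀ i k l, R.d i (Pi.single k 1) l ≠ 0 → R.deg i l ≤ R.deg (i + 1) k := fun i k l hl ↦
    (R.d_filtered i).mem_strand (single_mem_strand le_rfl 1) l hl
  choose f hf using fun i ↦ exists_linearMap_single (S := MvPolynomial V K)
    fun (k : R.ι (i + 1)) (l : R.ι i) ↦ monomial (R.deg (i + 1) k - R.deg i l)
      (R.d i (Pi.single k 1) l)
  obtain ⟨p, hp⟩ := exists_linearMap_single (S := MvPolynomial V K)
    fun k : R.ι 0 ↦ monomial (R.deg 0 k) (R.a (Pi.single k 1))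
  have hfc : ∀ i σ x, component (R.deg i) σ (f i x) = R.d i (component (R.deg (i + 1)) σ x) :=
    fun i ↦ component_linearMap_apply (hd i) fun k l ↦ congrFun (hf i k) l
  refine ⟨{
    ι := R.ι
    deg := R.deg
    d := f
    ε := (Submodule.mkQ I) ∘ₗ p
    d_homogeneous := ?_
    ε_homogeneous := ?_
    ε_surjective := ?_
    exact_zero := ?_
    exact_succ := ?_
    minimal := ?_ }⟩
  · intro i k l τ hτ
    rw [hf] at hτ
    have hτ' := Finset.mem_singleton.1 (support_monomial_subset hτ)
    have h0 : R.d i (Pi.single k 1) l ≠ 0 := fun h ↦ by simp [h] at hτ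
    rw [hτ', tsub_add_cancel_of_le (hd i k l h0)]
  · intro k
    refine ⟨monomial (R.deg 0 k) (R.a (Pi.single k 1)), ⟨_, rfl⟩, ?_⟩
    rw [LinearMap.comp_apply, hp]
    rfl
  · rw [← LinearMap.range_eq_top, eq_top_iff]
    -- The quotient is generated by the class of 1. If degree 0 is not in `C`, then 1 lies in `I`
    -- and the quotient is zero.
    suffices h : ∃ x, Ideal.Quotient.mk I (p x) = 1 by
      obtain ⟨x, hx⟩ := h
      intro y _
      obtain ⟨g, rfl⟩ := Ideal.Quotient.mk_surjective y
      refine ⟨g • x, ?_⟩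
      refine ((Submodule.mkQ I ∘ₗ p).map_smul g x).trans ?_
      refine (congrArg (g • ·) hx).trans ?_
      change Ideal.Quotient.mk I (g * 1) = _
      rw [mul_one]
    by_cases h0 : (0 : V →₀ ℕ) ∈ C
    · obtain ⟨x, hx, hax⟩ := R.a_surj 0 h0
      refine ⟨ofStrand (R.deg 0) 0 x, ?_⟩
      rw [← map_one (Ideal.Quotient.mk I)]
      congr 1
      ext τ
      rw [coeff_eq_apply_component hp, coeff_one]
      by_cases hτ : τ = 0
      · rw [hτ, component_ofStrand_self hx, hax, if_pos rfl]
      · rw [component_ofStrand_of_ne hx hτ, map_zero, if_neg (Ne.symm hτ)]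
    · refine ⟨0, ?_⟩
      rw [map_zero, map_zero, eq_comm, ← map_one (Ideal.Quotient.mk I),
        Ideal.Quotient.eq_zero_iff_mem, hI]
      intro σ hσ
      rw [coeff_one, if_neg]
      rintro rfl
      exact h0 hσ
  · exact (forall_mem_range_iff (hfc 0) (Z := fun x ↦ Ideal.Quotient.mk I (p x) = 0)
      (mk_eq_zero_iff_component hI hp) fun _ _ ↦ map_zero _).2 R.exact_zero
  · intro i
    refine (forall_mem_range_iff (hfc (i + 1)) (Z := fun x ↦ f i x = 0)
      (z := fun _ x ↦ R.d i x = 0) (fun x ↦ ?_) fun _ ↦ map_zero _).2 (R.exact_succ i)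
    rw [eq_zero_iff_component (deg := R.deg i)]
    simp only [hfc]
  · intro i x l
    by_contra h
    have h' : R.d i (component (R.deg (i + 1)) (R.deg i l) x) l ≠ 0 := by
      rw [← hfc, component_apply_of_le le_rfl, tsub_self]
      exact h
    obtain ⟨k, hk, hlk⟩ := R.d_strict i _ _ h'
    exact (hlk.trans_le (component_mem_strand x k hk)).false

/-- The strands of a minimal free resolution. -/
theorem MinimalFreeResolution.exists_strandResolution
    (hI : ∀ f, f ∈ I ↔ ∀ σ ∈ C, coeff σ f = 0)
    (F : MinimalFreeResolution (quotientGrading I)) :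
    ∃ R : StrandResolution K C, ∀ i, R.degrees i = Set.range (F.deg i) := by
  classical
  -- By homogeneity each matrix entry of the differential is a scalar times one monomial; `c`
  -- collects the scalars. The case distinction guards against truncated subtraction of exponents.
  choose c hc using fun i ↦ exists_linearMap_single (S := K)
    fun (k : F.ι (i + 1)) (l : F.ι i) ↦
      if F.deg i l ≤ F.deg (i + 1) k then
        coeff (F.deg (i + 1) k - F.deg i l) (F.d i (Pi.single k 1) l) else 0
  have hcd : ∀ i k l, c i (Pi.single k 1) l ≠ 0 → F.deg i l ≤ F.deg (i + 1) k := by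
    intro i k l h
    by_contra h'
    simp [hc, h'] at h
  have hd : ∀ i k l, F.d i (Pi.single k 1) l =
      monomial (F.deg (i + 1) k - F.deg i l) (c i (Pi.single k 1) l) := by
    intro i k l
    ext τ
    rw [coeff_monomial, hc]
    dsimp only
    by_cases hτ : coeff τ (F.d i (Pi.single k 1) l) = 0
    · split_ifs with h₁
      · rw [h₁]
      · exact hτ
      · exact hτ
    · have h := F.d_homogeneous i k l τ (mem_support_iff.2 hτ)
      have h' : F.deg i l ≤ F.deg (i + 1) k := h ▸ le_add_of_nonneg_left zero_le
      have h'' : F.deg (i + 1) k - F.deg i l = τ := by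
        rw [← h, add_tsub_cancel_right]
      rw [if_pos h'', if_pos h', h'']
  -- Between equal degrees an entry is a constant, which minimality excludes unless it is zero.
  have hstrict : ∀ i k l, c i (Pi.single k 1) l ≠ 0 → F.deg i l < F.deg (i + 1) k := by
    intro i k l h
    refine (hcd i k l h).lt_of_ne fun h' ↦ h ?_
    have := F.minimal i (Pi.single k 1) l
    rwa [hd, h', tsub_self, constantCoeff_monomial, if_pos rfl] at this
  have hfc : ∀ i σ x, component (F.deg i) σ (F.d i x) = c i (component (F.deg (i + 1)) σ x) :=
    fun i ↦ component_linearMap_apply (hcd i) (hd i)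
  have hε : ∀ k, ∃ r : K, (r ≠ 0 → F.deg 0 k ∈ C) ∧
      F.ε (Pi.single k 1) = Ideal.Quotient.mk I (monomial (F.deg 0 k) r) := by
    intro k
    obtain ⟨_, ⟨r, rfl⟩, hr⟩ := F.ε_homogeneous k
    -- A monomial of degree outside `C` lies in `I`, so its scalar may be replaced by 0, as `a_mem`
    -- demands.
    by_cases hk : F.deg 0 k ∈ C
    · exact ⟨r, fun _ ↦ hk, hr.symm⟩
    · refine ⟨0, fun h ↦ (h rfl).elim, hr.symm.trans ?_⟩
      rw [monomial_zero, map_zero]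
      refine Ideal.Quotient.eq_zero_iff_mem.2 ((hI _).2 fun σ hσ ↦ ?_)
      rw [coeff_monomial, if_neg]
      rintro rfl
      exact hk hσ
  choose r hrC hr using hε
  obtain ⟨a, ha⟩ := exists_linearMap_single (S := K) r
  obtain ⟨p, hp⟩ := exists_linearMap_single (S := MvPolynomial V K)
    fun k : F.ι 0 ↦ monomial (F.deg 0 k) (a (Pi.single k 1))
  have hεp : ∀ x, F.ε x = Ideal.Quotient.mk I (p x) := by
    intro x
    rw [linearMap_apply_eq_sum_single F.ε, linearMap_apply_eq_sum_single p, map_sum]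
    refine Finset.sum_congr rfl fun k _ ↦ ?_
    rw [hr, hp, ha]
    rfl
  let R : StrandResolution K C :=
    { ι := F.ι
      deg := F.deg
      d := c
      a := a
      d_strict := fun i ↦ isStrictlyFiltered_of_single (hstrict i)
      a_mem := by
        intro x hx
        rw [linearMap_apply_eq_sum_single a] at hx
        obtain ⟨k, -, hk⟩ := Finset.exists_ne_zero_of_sum_ne_zero hx
        rw [ha] at hk
        exact ⟨k, left_ne_zero_of_mul hk, hrC k (right_ne_zero_of_mul hk)⟩
      a_surj := by
        intro σ hσ
        obtain ⟨x, hx⟩ := F.ε_surjective (Ideal.Quotient.mk I (monomial σ 1))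
        rw [hεp, Ideal.Quotient.eq, hI] at hx
        refine ⟨component (F.deg 0) σ x, component_mem_strand x, ?_⟩
        rw [← coeff_eq_apply_component hp]
        simpa [sub_eq_zero] using hx σ hσ
      exact_zero := by
        refine (forall_mem_range_iff (hfc 0) (Z := fun x ↦ F.ε x = 0)
          (z := fun σ x ↦ σ ∈ C → a x = 0) (fun x ↦ ?_) fun _ _ ↦ map_zero _).1 F.exact_zero
        rw [hεp]
        exact mk_eq_zero_iff_component hI hp x
      exact_succ := by
        intro i
        refine (forall_mem_range_iff (hfc (i + 1)) (Z := fun x ↦ F.d i x = 0)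
          (z := fun _ x ↦ c i x = 0) (fun x ↦ ?_) fun _ ↦ map_zero _).1 (F.exact_succ i)
        rw [eq_zero_iff_component (deg := F.deg i)]
        simp only [hfc] }
  exact ⟨R, fun _ ↦ rfl⟩

theorem MinimalFreeResolution.betti_ne_zero_iff {M : Type*} [AddCommGroup M] [Module K M]
    [Module (MvPolynomial V K) M] {ℳ : (V →₀ ℕ) → Submodule K M} (F : MinimalFreeResolution ℳ)
    (i : ℕ) (σ : V →₀ ℕ) : F.betti i σ ≠ 0 ↔ σ ∈ Set.range (F.deg i) := by
  rw [MinimalFreeResolution.betti, Nat.card_ne_zero]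
  simp [Set.mem_range, nonempty_subtype, Subtype.finite]

end Comparison

end EdgeIdeal

/-! ### The edge ideal, the invariants of the graph, and the conclusion. -/

namespace EdgeIdeal

open MvPolynomial

variable {V K : Type*} [Field K]

theorem mem_edgeIdeal_iff [Fintype V] {G : SimpleGraph V} (f : MvPolynomial V K) :
    f ∈ edgeIdeal K G ↔ ∀ σ ∈ edgeCompl G Finset.univ, coeff σ f = 0 := by
  classical
  have h : edgeIdeal K G = Ideal.span ((fun σ ↦ monomial σ (1 : K)) ''
      {σ | ∃ u v, G.Adj u v ∧ σ = Finsupp.single u 1 + Finsupp.single v 1}) := by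
    rw [edgeIdeal]
    congr 1
    ext g
    constructor
    · rintro ⟨u, v, huv, rfl⟩
      exact ⟨_, ⟨u, v, huv, rfl⟩, by simp [X, monomial_mul]⟩
    · rintro ⟨_, ⟨u, v, huv, rfl⟩, rfl⟩
      exact ⟨u, v, huv, by simp [X, monomial_mul]⟩
  rw [h, mem_ideal_span_monomial_image]
  have key : ∀ σ : V →₀ ℕ, (∃ τ ∈ {τ : V →₀ ℕ | ∃ u v, G.Adj u v ∧
      τ = Finsupp.single u 1 + Finsupp.single v 1}, τ ≤ σ) ↔ σ ∉ edgeCompl G Finset.univ := by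
    intro σ
    constructor
    · rintro ⟨_, ⟨u, v, huv, rfl⟩, hle⟩ hσ
      have hu := hle u
      have hv := hle v
      simp only [Finsupp.add_apply, Finsupp.single_eq_same] at hu hv
      rcases hσ u (Finset.mem_univ u) v (Finset.mem_univ v) huv with h | h <;> omega
    · intro hσ
      simp only [edgeCompl, Set.mem_ofPred_eq, not_forall, not_or] at hσ
      obtain ⟨u, -, v, -, huv, hu, hv⟩ := hσ
      refine ⟨_, ⟨u, v, huv, rfl⟩, fun w ↦ ?_⟩
      simp only [Finsupp.add_apply, Finsupp.single_apply]
      split_ifs with h₁ h₂ h₂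
      · exact (huv.ne (h₁.trans h₂.symm)).elim
      · subst h₁
        omega
      · subst h₂
        omega
      · omega
  simp only [key, mem_support_iff]
  exact forall_congr' fun σ ↦ not_imp_not

/-- Among the endpoints of the two edges some vertex has neighbours covering both edges. It lies on
one of them, so it is adjacent to an endpoint of the other, which gives a further edge on the union.
-/
theorem not_threeDisjoint {G : SimpleGraph V} (hG : IsCochordal G) {e₁ e₂ : Sym2 V}
    (h₁ : e₁ ∈ G.edgeSet) (h₂ : e₂ ∈ G.edgeSet) : ¬ ThreeDisjoint G e₁ e₂ := by
  classical
  rintro ⟨hdisj, hset⟩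
  have key : ∀ v w, v ∈ e₁ → w ∈ e₂ → ¬ G.Adj v w := by
    intro v w hv hw hvw
    have hmem : s(v, w) ∈ ({e₁, e₂} : Set (Sym2 V)) := by
      rw [← hset]
      refine ⟨hvw, fun u hu ↦ ?_⟩
      rcases Sym2.mem_iff.1 hu with rfl | rfl
      · exact .inl hv
      · exact .inr hw
    rcases hmem with h | h
    · exact hdisj w ⟨h ▸ Sym2.mem_mk_right v w, hw⟩
    · exact hdisj v ⟨hv, h ▸ Sym2.mem_mk_left v w⟩
  induction e₁ using Sym2.ind with | _ a b =>
  induction e₂ using Sym2.ind with | _ c d =>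
  obtain ⟨v, hv, hcov⟩ := hG.exists_neighbors_cover (W := {a, b, c, d}) (by simp)
  have hv' : v ∈ s(a, b) ∨ v ∈ s(c, d) := by
    simpa [or_assoc] using hv
  rcases hv' with hv | hv
  · rcases hcov c (by simp) d (by simp) h₂ with h | h
    · exact key v c hv (Sym2.mem_mk_left c d) h
    · exact key v d hv (Sym2.mem_mk_right c d) h
  · rcases hcov a (by simp) b (by simp) h₁ with h | h
    · exact key a v (Sym2.mem_mk_left a b) hv h.symm
    · exact key b v (Sym2.mem_mk_right a b) hv h.symm

theorem isGreatest_threeDisjointCards {G : SimpleGraph V} (hne : G.edgeSet.Nonempty)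
    (hG : IsCochordal G) : IsGreatest (threeDisjointCards G) 1 := by
  constructor
  · obtain ⟨e, he⟩ := hne
    exact ⟨{e}, by simpa using he, by simp, by simp⟩
  · rintro _ ⟨A, hA, hdisj, rfl⟩
    refine Finset.card_le_one.2 fun e₁ h₁ e₂ h₂ ↦ ?_
    by_contra h
    exact not_threeDisjoint hG (hA h₁) (hA h₂) (hdisj h₁ h₂ h)

theorem mem_completeBipartiteValues_iff {G : SimpleGraph V} {p : ℕ} :
    p ∈ completeBipartiteValues G ↔ ∃ A B : Finset V, A.Nonempty ∧ B.Nonempty ∧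
      (∀ a ∈ A, ∀ b ∈ B, G.Adj a b) ∧ p = A.card + B.card - 1 := by
  simp only [completeBipartiteValues, Set.mem_ofPred_eq,
    SimpleGraph.completeBipartiteGraph_isContained_iff, Fintype.card_fin]
  constructor
  · rintro ⟨m, n, hm, hn, ⟨A, B, rfl, rfl, hAB⟩, rfl⟩
    exact ⟨A, B, Finset.card_pos.1 hm, Finset.card_pos.1 hn, fun a ha b hb ↦ hAB ha hb, rfl⟩
  · rintro ⟨A, B, hA, hB, hAB, rfl⟩
    exact ⟨_, _, hA.card_pos, hB.card_pos, ⟨A, B, rfl, rfl, fun a ha b hb ↦ hAB a ha b hb⟩, rfl⟩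

theorem exists_isGreatest_completeBipartiteValues [Fintype V] {G : SimpleGraph V}
    (hne : G.edgeSet.Nonempty) : ∃ p, IsGreatest (completeBipartiteValues G) p := by
  have hS : (completeBipartiteValues G).Nonempty := by
    obtain ⟨e, he⟩ := hne
    induction e using Sym2.ind with | _ a b =>
    exact ⟨_, mem_completeBipartiteValues_iff.2 ⟨{a}, {b}, by simp, by simp, by simpa using he,
      rfl⟩⟩
  have hb : BddAbove (completeBipartiteValues G) := by
    refine ⟨Fintype.card V + Fintype.card V, fun p hp ↦ ?_⟩
    obtain ⟨A, B, -, -, -, rfl⟩ := mem_completeBipartiteValues_iff.1 hp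
    have := A.card_le_univ
    have := B.card_le_univ
    omega
  exact ⟨sSup _, Nat.sSup_mem hS hb, fun _ h ↦ le_csSup hb h⟩

theorem hasBipartite_univ_iff [Fintype V] {G : SimpleGraph V} {p i : ℕ}
    (hp : IsGreatest (completeBipartiteValues G) p) :
    HasBipartite G Finset.univ (i + 2) ↔ i + 1 ≤ p := by
  constructor
  · rintro ⟨A, B, -, -, hA, hB, hAB, hcard⟩
    have := hp.2 (mem_completeBipartiteValues_iff.2 ⟨A, B, hA, hB, hAB, rfl⟩)
    omega
  · intro h
    obtain ⟨A, B, hA, hB, hAB, hcard⟩ := mem_completeBipartiteValues_iff.1 hp.1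
    exact ⟨A, B, A.subset_univ, B.subset_univ, hA, hB, hAB, by omega⟩

theorem one_le_of_isGreatest {G : SimpleGraph V} {p : ℕ}
    (hp : IsGreatest (completeBipartiteValues G) p) : 1 ≤ p := by
  obtain ⟨A, B, hA, hB, -, rfl⟩ := mem_completeBipartiteValues_iff.1 hp.1
  have := hA.card_pos
  have := hB.card_pos
  omega

end EdgeIdeal

/-- Since all minimal graded free resolutions of a module are isomorphic, `reg` and `pd` are read
off from any of them; the statement asserts that one exists and treats all of them. -/
theorem corollary5p3 {V : Type*} [Finite V] (K : Type*) [Field K] (G : SimpleGraph V)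
    (hne : G.edgeSet.Nonempty) (hG : EdgeIdeal.IsCochordal G) :
    IsGreatest (EdgeIdeal.threeDisjointCards G) 1 ∧
    Nonempty (EdgeIdeal.MinimalFreeResolution
      (EdgeIdeal.quotientGrading (EdgeIdeal.edgeIdeal K G))) ∧
    ∃ p : ℕ, IsGreatest (EdgeIdeal.completeBipartiteValues G) p ∧
      ∀ F : EdgeIdeal.MinimalFreeResolution
          (EdgeIdeal.quotientGrading (EdgeIdeal.edgeIdeal K G)),
        F.HasRegularity 1 ∧ F.HasProjDim p := by
  classical
  obtain ⟨_⟩ := nonempty_fintype V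
  obtain ⟨p, hp⟩ := EdgeIdeal.exists_isGreatest_completeBipartiteValues hne
  obtain ⟨R, hR, hdeg, hRne⟩ := EdgeIdeal.exists_resolution_edgeCompl K
    (fun _ hW ↦ hG.exists_neighbors_cover hW) Finset.univ
  refine ⟨EdgeIdeal.isGreatest_threeDisjointCards hne hG,
    R.exists_minimalFreeResolution EdgeIdeal.mem_edgeIdeal_iff, p, hp, fun F ↦ ?_⟩
  obtain ⟨T, hT⟩ := F.exists_strandResolution EdgeIdeal.mem_edgeIdeal_iff
  -- Uniqueness of minimal resolutions transfers the degrees of the constructed `R` to the arbitrary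
  -- `F`.
  have hbetti : ∀ i σ, F.betti i σ ≠ 0 ↔ σ ∈ R.degrees i := fun i σ ↦ by
    rw [F.betti_ne_zero_iff, ← hT, T.degrees_eq R]
  have hRp : ∀ i, (R.degrees (i + 1)).Nonempty ↔ i + 1 ≤ p := fun i ↦
    (hRne i).trans (EdgeIdeal.hasBipartite_univ_iff hp)
  have hp₁ := EdgeIdeal.one_le_of_isGreatest hp
  refine ⟨⟨?_, ?_⟩, ?_, ?_⟩
  · obtain ⟨σ, hσ⟩ := (hRp 0).2 hp₁
    refine ⟨1, σ, (hbetti 1 σ).2 hσ, ?_⟩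
    rw [hdeg 0 σ hσ]
    norm_num
  -- Place 0 contributes 0; every later place that occurs contributes (i + 2) - (i + 1) = 1.
  · rintro _ ⟨_ | i, σ, hσ, rfl⟩
    · rw [hbetti, hR.degrees_zero, Set.mem_singleton_iff] at hσ
      simp [hσ, bot_eq_zero]
    · rw [hdeg i σ ((hbetti _ _).1 hσ)]
      push_cast
      omega
  · obtain ⟨i, rfl⟩ : ∃ i, p = i + 1 := ⟨p - 1, by omega⟩
    obtain ⟨σ, hσ⟩ := (hRp i).2 le_rfl
    exact ⟨σ, (hbetti _ _).2 hσ⟩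
  · rintro (_ | i) ⟨σ, hσ⟩
    · exact Nat.zero_le p
    · exact (hRp i).1 ⟨σ, (hbetti _ _).1 hσ⟩
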